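/- Throughout, $\log=\log_2$. For every constant $c>0$ there are a constant $C>0$ and a decoder $D$ (a deterministic function whose arguments are two bit strings and a finite set of bit strings, and whose value is a truth value), both depending only on $c$, such that the following holds. Let $G=(V,E)$ be any finite simple undirected graph, not necessarily connected, with $n=|V|\ge 2$ vertices, and let $f$ be any integer with $f\ge 2\log^2 n$. Then there is a random pair of labeling functions $(L_V,L_E)$, where $L_V$ assigns to every vertex a bit string of length at most $C\log n$ and $L_E$ assigns to every edge a bit string of length at most $C\log^2 n\cdot\log(f/\log^2 n)$, such that for each fixed query $\langle s,t,F\rangle$ with $s,t\in V$, $F\subseteq E$ and $|F|\le f$, with probability at least $1-n^{-c}$ over the choice of $(L_V,L_E)$, $$D\bigl(L_V(s),\,L_V(t),\,\{L_E(e)\mid e\in F\}\bigr)=\text{true}\iff s\text{ and }t\text{ are connected in }G-F .$$ In other words, there are randomized labels for connectivity under at most $f$ edge faults, with $O(\log n)$ bits per vertex and $O(\log^2 n\cdot\log(f/\log^2 n))$ bits per edge, from which each query is answered correctly with high probability by inspecting only the labels of $s$, $t$ and the edges of $F$. -/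

import Mathlib

/-- Finite bit strings; the size in bits of a label is its `List.length`. -/
abbrev BitString := List Bool

/-- A pair of labeling functions `L = (L_V, L_E)`, labeling the vertices and the edges of `G`. -/
abbrev VertexEdgeLabels {V : Type*} (G : SimpleGraph V) :=
  (V → BitString) × (G.edgeSet → BitString)

/-- A decoder sees the labels of `s` and `t` and the (unordered) set of the labels of the faulty
edges, and nothing else; in particular it does not see the graph. -/
abbrev LabelDecoder := BitString → BitString → Finset BitString → Bool

/-- The answer of the decoder `D` to the query `⟨s, t, F⟩` under the labels `L` is right:
it says `true` exactly when `s` and `t` are connected in `G - F`. -/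
def AnswersCorrectly {V : Type*} {G : SimpleGraph V} (D : LabelDecoder) (L : VertexEdgeLabels G)
    (s t : V) (F : Finset G.edgeSet) : Prop :=
  D (L.1 s) (L.1 t) (F.image L.2) = true ↔
    (G.deleteEdges ((↑) '' (F : Set G.edgeSet))).Reachable s t

/-! The decoder never sees the graph, so the labels must let it compute, for suitable vertex
functions `χ` with values in `ZMod 2`, a linear sketch of the set of surviving edges that `χ`
separates. A spanning forest makes this possible. Its fundamental cuts form a basis of the cuts, so
on every edge of `G` the coboundary of `χ` is the combination, over the forest edges that `χ`
separates, of their fundamental cuts (`HasIntervalCuts.coboundary_eq_sum`). If `χ` respects the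
partition cut out by the fundamental cuts of `F`, only edges of `F` enter. The label of `e` stores
the sum of edge values over its fundamental cut plus the value of `e` itself; the matching
combination of these labels over `F` is then the sum of the values over the cut of `χ` in `G - F`,
the faulty edges cancelling modulo 2 (`HasIntervalCuts.sum_edgeSketch`). In a suitable vertex order
every fundamental cut has an interval as a side, so two numbers describe it, and `F` cuts the
vertices into at most `2|F| + 1` classes.

The decoder merges these classes as in Borůvka's algorithm. Each round has fresh nested edge samples
at rates `1, 1/2, 1/4, …`; for a typical class some rate leaves between 1 and 512 outgoing edges.
The sketch is a polynomial fingerprint evaluated at a random `z`, and a small sampled cut is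
recovered by exhaustive search. While at least `T = O(log n)` classes are active, a round fails to
shrink their number to three quarters with probability at most `2 / 2 ^ T`
(`freq_slow_mergeStep_le`). Each round costs `O(log² n)` bits per edge.

Merging down to one class per component would cost `log f` rounds. Instead it stops after about `3
log (f / log² n)` rounds, when `k = O(log² n)` active classes remain. They span at most `2 ^ k`
cuts, so one further fingerprint of `k + O(log n)` bits tells the empty cut from all the others at
once (`freq_not_cutsDetected_le`). Then `s` and `t` are connected exactly when they lie in one
component of `G` and no function with an empty cut tells them apart (`decidesConnected_iff`).

All failure events are measured along an ideal run that uses the true sampled cuts. This run depends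
on the samples only, so the evaluation points are independent of it and union bounds apply. -/

/-! ### Coboundaries and cuts modulo 2 -/

/-- The coboundary of a `0/1`-function on the vertices: it is `1` on the pairs that the function
separates. -/
def coboundary {V : Type*} : (V → ZMod 2) →ₗ[ZMod 2] (Sym2 V → ZMod 2) where
  toFun χ := Sym2.lift ⟨fun x y => χ x + χ y, fun _ _ => add_comm _ _⟩
  map_add' χ ψ := by
    ext e
    induction e using Sym2.ind with
    | _ x y => simp only [Sym2.lift_mk, Pi.add_apply]; ring
  map_smul' c χ := by
    ext e
    induction e using Sym2.ind with
    | _ x y => simp only [Sym2.lift_mk, Pi.smul_apply, smul_eq_mul, RingHom.id_apply]; ring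

@[simp] theorem coboundary_mk {V : Type*} (χ : V → ZMod 2) (x y : V) :
    coboundary χ s(x, y) = χ x + χ y := rfl

theorem coboundary_mk_eq_zero {V : Type*} {χ : V → ZMod 2} {x y : V} :
    coboundary χ s(x, y) = 0 ↔ χ x = χ y := by
  rw [coboundary_mk, add_eq_zero_iff_eq_neg, ZMod.neg_eq_self_mod_two]

/-- The indicator function of a set of vertices, with values in `ZMod 2`. -/
noncomputable def cutIndicator {V : Type*} (S : Set V) : V → ZMod 2 := S.indicator 1

theorem cutIndicator_eq_iff {V : Type*} {S : Set V} {x y : V} :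
    cutIndicator S x = cutIndicator S y ↔ (x ∈ S ↔ y ∈ S) := by
  classical
  by_cases hx : x ∈ S <;> by_cases hy : y ∈ S <;> simp [cutIndicator, hx, hy]

/-! ### Spanning forests with convex fundamental cuts -/

/-- A spanning forest `τ` of the part of `G` inside `W`, with the sides `D e` of its fundamental
cuts, and an order of `W` in which all these sides are convex. -/
structure IsOrderedForest {V : Type*} (G : SimpleGraph V) (W : Set V) (pos : V → ℕ)
    (τ : Set (Sym2 V)) (D : Sym2 V → Set V) : Prop where
  injOn : Set.InjOn pos W
  mem_edgeSet : ∀ e ∈ τ, e ∈ G.edgeSet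
  mem_of_mem : ∀ e ∈ τ, ∀ x ∈ e, x ∈ W
  subset : ∀ e, D e ⊆ W
  convex : ∀ e ∈ τ, ∀ x ∈ D e, ∀ z ∈ D e, ∀ y ∈ W, pos x ≤ pos y → pos y ≤ pos z → y ∈ D e
  separates : ∀ e ∈ τ, ∀ e' ∈ τ, (coboundary (cutIndicator (D e)) e' = 0 ↔ e ≠ e')
  spans : ∀ χ : V → ZMod 2, (∀ e ∈ τ, coboundary χ e = 0) →
    ∀ x ∈ W, ∀ y ∈ W, G.Reachable x y → χ x = χ y

theorem IsOrderedForest.empty {V : Type*} (G : SimpleGraph V) :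
    IsOrderedForest G ∅ (fun _ => 0) ∅ (fun _ => ∅) := by
  constructor <;> simp

theorem IsOrderedForest.insert_root {V : Type*} {G : SimpleGraph V} {W : Set V} {pos : V → ℕ}
    {τ : Set (Sym2 V)} {D : Sym2 V → Set V} (h : IsOrderedForest G W pos τ D) {v : V} (hv : v ∉ W)
    (hW : ∀ u ∈ W, ∀ w, G.Adj u w → w ∈ W) :
    ∃ pos' τ' D', IsOrderedForest G (insert v W) pos' τ' D' := by
  classical
  have hreach : ∀ x ∈ W, ∀ y, G.Reachable x y → y ∈ W := by
    rintro x hx y ⟨p⟩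
    induction p with
    | nil => exact hx
    | cons hadj _ ih => exact ih (hW _ hx _ hadj)
  -- The new root goes in front of everything: it lies in no `D e`, so convexity is unaffected.
  refine ⟨fun x => if x = v then 0 else pos x + 1, τ, D, ?_⟩
  have hne : ∀ x ∈ W, x ≠ v := fun x hx hxv => hv (hxv ▸ hx)
  constructor
  · intro x hx y hy hxy
    rcases hx with rfl | hx <;> rcases hy with rfl | hy
    · rfl
    · simp [hne y hy] at hxy
    · simp [hne x hx] at hxy
    · simp only [hne x hx, hne y hy, if_false] at hxy
      exact h.injOn hx hy (by omega)
  · exact h.mem_edgeSet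
  · exact fun e he x hx => Or.inr (h.mem_of_mem e he x hx)
  · exact fun e => (h.subset e).trans (Set.subset_insert _ _)
  · intro e he x hx z hz y hy hxy hyz
    have hx' := hne x (h.subset e hx)
    have hz' := hne z (h.subset e hz)
    rcases hy with rfl | hy
    · simp [hx'] at hxy
    · simp only [hx', hz', hne y hy, if_false] at hxy hyz
      exact h.convex e he x hx z hz y hy (by omega) (by omega)
  · exact h.separates
  · intro χ hχ x hx y hy hr
    rcases hx with rfl | hx <;> rcases hy with rfl | hy
    · rfl
    · exact absurd (hreach y hy _ hr.symm) hv
    · exact absurd (hreach x hx _ hr) hv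
    · exact h.spans χ hχ x hx y hy hr

/-- The leaf `v` is put right behind its parent `u`, and on the same side as `u` of every old
fundamental cut. A convex set containing `u` stays convex when `v` joins it, and one avoiding `u`
does not reach across the new place. The new edge has the side `{v}`. -/
theorem IsOrderedForest.insert_leaf {V : Type*} {G : SimpleGraph V} {W : Set V} {pos : V → ℕ}
    {τ : Set (Sym2 V)} {D : Sym2 V → Set V} (h : IsOrderedForest G W pos τ D) {u v : V}
    (hu : u ∈ W) (hv : v ∉ W) (huv : G.Adj u v) :
    ∃ pos' τ' D', IsOrderedForest G (insert v W) pos' τ' D' := by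
  classical
  have hne : ∀ x ∈ W, x ≠ v := fun x hx hxv => hv (hxv ▸ hx)
  have hnew : s(u, v) ∉ τ := fun hmem => hv (h.mem_of_mem _ hmem v (by simp))
  set D' : Sym2 V → Set V := fun e =>
    if e = s(u, v) then {v} else if u ∈ D e then insert v (D e) else D e with hD'
  have hDnew : D' s(u, v) = {v} := by simp [hD']
  have hDW : ∀ e ∈ τ, ∀ x ∈ W, (x ∈ D' e ↔ x ∈ D e) := by
    intro e he x hx
    have : e ≠ s(u, v) := fun h' => hnew (h' ▸ he)
    simp only [hD', this, if_false]
    split_ifs <;> simp [hne x hx]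
  have hDv : ∀ e ∈ τ, (v ∈ D' e ↔ u ∈ D e) := by
    intro e he
    have : e ≠ s(u, v) := fun h' => hnew (h' ▸ he)
    have hvD : v ∉ D e := fun h' => hv (h.subset e h')
    simp only [hD', this, if_false]
    split_ifs with h1 <;> simp [h1, hvD]
  -- Doubling the old positions frees an odd position directly after `u`.
  refine ⟨fun x => if x = v then 2 * pos u + 1 else 2 * pos x, insert s(u, v) τ, D', ?_⟩
  have hmem : ∀ e ∈ insert s(u, v) τ, ∀ x ∈ e, x ∈ insert v W := by
    rintro e (rfl | he) x hx
    · rcases Sym2.mem_iff.1 hx with rfl | rfl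
      · exact Or.inr hu
      · exact Or.inl rfl
    · exact Or.inr (h.mem_of_mem e he x hx)
  constructor
  · intro x hx y hy hxy
    rcases hx with rfl | hx <;> rcases hy with rfl | hy
    · rfl
    · simp only [hne y hy, if_true, if_false] at hxy; omega
    · simp only [hne x hx, if_true, if_false] at hxy; omega
    · simp only [hne x hx, hne y hy, if_false] at hxy
      exact h.injOn hx hy (by omega)
  · rintro e (rfl | he)
    · exact huv
    · exact h.mem_edgeSet e he
  · exact hmem
  · intro e
    simp only [hD']
    split_ifs
    · simp
    · exact Set.insert_subset_insert (h.subset e)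
    · exact (h.subset e).trans (Set.subset_insert _ _)
  · rintro e (rfl | he) x hx z hz y hy hxy hyz
    · rw [hDnew] at hx hz ⊢
      rw [Set.mem_singleton_iff] at hx hz ⊢
      subst hx
      rcases hy with rfl | hy
      · rfl
      · subst hz
        simp only [hne y hy, if_true, if_false] at hxy hyz; omega
    -- Replacing `v` by `u` turns members of `D' e` into members of `D e`; the old convexity applies
    -- to the replacements.
    · have key : ∀ x ∈ D' e, ∃ x' ∈ D e, (x = v ∧ x' = u) ∨ (x ∈ W ∧ x' = x) := by
        intro x hx
        by_cases hxv : x = v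
        · subst hxv
          exact ⟨u, (hDv e he).1 hx, Or.inl ⟨rfl, rfl⟩⟩
        · have hxW : x ∈ W := by
            simp only [hD'] at hx
            split_ifs at hx with h1 h2
            · exact absurd hx hxv
            · exact h.subset e (hx.resolve_left hxv)
            · exact h.subset e hx
          exact ⟨x, (hDW e he x hxW).1 hx, Or.inr ⟨hxW, rfl⟩⟩
      obtain ⟨x', hx', hxx⟩ := key x hx
      obtain ⟨z', hz', hzz⟩ := key z hz
      rcases hy with rfl | hy
      · rw [hDv e he]
        refine h.convex e he x' hx' z' hz' u hu ?_ ?_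
        · rcases hxx with ⟨-, rfl⟩ | ⟨hxW, rfl⟩
          · rfl
          · simp only [hne _ hxW, if_true, if_false] at hxy; omega
        · rcases hzz with ⟨-, rfl⟩ | ⟨hzW, rfl⟩
          · rfl
          · simp only [hne _ hzW, if_true, if_false] at hyz; omega
      · rw [hDW e he y hy]
        refine h.convex e he x' hx' z' hz' y hy ?_ ?_
        · rcases hxx with ⟨rfl, rfl⟩ | ⟨hxW, rfl⟩
          · simp only [hne _ hy, if_true, if_false] at hxy; omega
          · simp only [hne _ hxW, hne _ hy, if_false] at hxy; omega
        · rcases hzz with ⟨rfl, rfl⟩ | ⟨hzW, rfl⟩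
          · simp only [hne _ hy, if_true, if_false] at hyz; omega
          · simp only [hne _ hzW, hne _ hy, if_false] at hyz; omega
  · have hold : ∀ e ∈ τ, ∀ e' ∈ τ,
        coboundary (cutIndicator (D' e)) e' = coboundary (cutIndicator (D e)) e' := by
      intro e he e' he'
      have hW' := h.mem_of_mem e' he'
      induction e' using Sym2.ind with
      | _ x y =>
        have hx := hDW e he x (hW' x (by simp))
        have hy := hDW e he y (hW' y (by simp))
        simp only [coboundary_mk, cutIndicator, Set.indicator_apply, hx, hy]
    rintro e (rfl | he) e' (rfl | he')
    · rw [coboundary_mk_eq_zero, cutIndicator_eq_iff, hDnew]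
      simp [hne u hu]
    · have hW' := h.mem_of_mem e' he'
      have : s(u, v) ≠ e' := fun h' => hnew (h' ▸ he')
      simp only [this, ne_eq, not_false_eq_true, iff_true]
      induction e' using Sym2.ind with
      | _ x y =>
        rw [coboundary_mk_eq_zero, cutIndicator_eq_iff, hDnew]
        simp [hne x (hW' x (by simp)), hne y (hW' y (by simp))]
    · have : e ≠ s(u, v) := fun h' => hnew (h' ▸ he)
      simp only [this, ne_eq, not_false_eq_true, iff_true]
      rw [coboundary_mk_eq_zero, cutIndicator_eq_iff, hDv e he, hDW e he u hu]
    · rw [hold e he e' he', h.separates e he e' he']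
  · intro χ hχ
    have h1 : χ u = χ v := coboundary_mk_eq_zero.1 (hχ _ (Or.inl rfl))
    have h2 := h.spans χ fun e he => hχ e (Or.inr he)
    intro x hx y hy hr
    rcases hx with rfl | hx <;> rcases hy with rfl | hy
    · rfl
    · rw [← h1]; exact h2 u hu y hy (huv.reachable.trans hr)
    · rw [← h1]; exact h2 x hx u hu (hr.trans huv.symm.reachable)
    · exact h2 x hx y hy hr

/-- Vertices are added one at a time: as a leaf if some edge leaves the current set, and otherwise
as the root of a new tree, the current set then being a union of components. -/
theorem exists_isOrderedForest {V : Type*} [Fintype V] (G : SimpleGraph V) :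
    ∃ pos τ D, IsOrderedForest G Set.univ pos τ D := by
  classical
  have key : ∀ k ≤ Fintype.card V, ∃ W : Finset V, W.card = k ∧
      ∃ pos τ D, IsOrderedForest G (W : Set V) pos τ D := by
    intro k
    induction k with
    | zero => exact fun _ => ⟨∅, rfl, _, _, _, by simpa using IsOrderedForest.empty G⟩
    | succ k ih =>
      intro hk
      obtain ⟨W, hW, pos, τ, D, h⟩ := ih (by omega)
      by_cases hadj : ∃ u ∈ W, ∃ v, v ∉ W ∧ G.Adj u v
      · obtain ⟨u, hu, v, hv, huv⟩ := hadj
        refine ⟨insert v W, by rw [Finset.card_insert_of_notMem hv, hW], ?_⟩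
        rw [Finset.coe_insert]
        exact h.insert_leaf (Finset.mem_coe.2 hu) (by simpa using hv) huv
      · push Not at hadj
        obtain ⟨v, hv⟩ : ∃ v, v ∉ W := by
          by_contra hall
          push Not at hall
          have : W = Finset.univ := Finset.eq_univ_iff_forall.2 hall
          rw [this, Finset.card_univ] at hW
          omega
        refine ⟨insert v W, by rw [Finset.card_insert_of_notMem hv, hW], ?_⟩
        rw [Finset.coe_insert]
        refine h.insert_root (by simpa using hv) fun u hu w huw => ?_
        by_contra hw
        exact hadj u (by simpa using hu) w (by simpa using hw) huw
  obtain ⟨W, hW, pos, τ, D, h⟩ := key _ le_rfl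
  rw [Finset.card_eq_iff_eq_univ] at hW
  subst hW
  exact ⟨pos, τ, D, by simpa using h⟩

/-! ### Fundamental cuts as intervals -/

/-- The indicator function of an interval of vertices. -/
noncomputable def intervalIndicator {n : ℕ} (lo hi : Fin (n + 1)) : Fin n → ZMod 2 :=
  cutIndicator {v : Fin n | (lo : ℕ) ≤ v ∧ (v : ℕ) < hi}

/-- A spanning forest `τ` of `G` whose fundamental cuts have the intervals `[lo e, hi e)`
as sides; the interval of an edge outside the forest is empty. -/
structure HasIntervalCuts {n : ℕ} (G : SimpleGraph (Fin n)) (lo hi : Sym2 (Fin n) → Fin (n + 1))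
    (τ : Set (Sym2 (Fin n))) : Prop where
  mem_edgeSet : ∀ e ∈ τ, e ∈ G.edgeSet
  eq_zero : ∀ e ∉ τ, intervalIndicator (lo e) (hi e) = 0
  separates : ∀ e ∈ τ, ∀ e' ∈ τ,
    (coboundary (intervalIndicator (lo e) (hi e)) e' = 0 ↔ e ≠ e')
  spans : ∀ χ : Fin n → ZMod 2, (∀ e ∈ τ, coboundary χ e = 0) →
    ∀ x y, G.Reachable x y → χ x = χ y

theorem exists_interval_of_convex {n : ℕ} (S : Set (Fin n))
    (hS : ∀ x ∈ S, ∀ z ∈ S, ∀ y, x ≤ y → y ≤ z → y ∈ S) :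
    ∃ lo hi : Fin (n + 1), S = {v : Fin n | (lo : ℕ) ≤ v ∧ (v : ℕ) < hi} := by
  rcases S.eq_empty_or_nonempty with rfl | hne
  · exact ⟨0, 0, by ext; simp⟩
  · obtain ⟨a, ha, hmin⟩ := S.toFinite.exists_minimalFor id S hne
    obtain ⟨b, hb, hmax⟩ := S.toFinite.exists_maximalFor id S hne
    refine ⟨a.castSucc, b.succ, ?_⟩
    ext v
    simp only [Set.mem_ofPred_eq, Fin.val_castSucc, Fin.val_succ]
    constructor
    · intro hv
      have h1 : a ≤ v := (le_total a v).elim id fun h => hmin hv h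
      have h2 : v ≤ b := (le_total v b).elim id fun h => hmax hv h
      exact ⟨h1, Nat.lt_succ_of_le h2⟩
    · rintro ⟨h1, h2⟩
      exact hS a ha b hb v h1 (Nat.le_of_lt_succ h2)

theorem coboundary_comp {V W : Type*} (f : V → W) (χ : W → ZMod 2) (e : Sym2 V) :
    coboundary (χ ∘ f) e = coboundary χ (e.map f) := by
  induction e using Sym2.ind with
  | _ x y => rfl

theorem exists_hasIntervalCuts {V : Type*} [Fintype V] (G : SimpleGraph V) {n : ℕ}
    (hn : Fintype.card V = n) :
    ∃ (pos : V ≃ Fin n) (lo hi : Sym2 (Fin n) → Fin (n + 1)) (τ : Set (Sym2 (Fin n))),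
      HasIntervalCuts (G.comap pos.symm) lo hi τ := by
  classical
  obtain ⟨rank, τ, D, h⟩ := exists_isOrderedForest G
  have hinj : Function.Injective rank := Set.injOn_univ.1 h.injOn
  let _ : LinearOrder V := LinearOrder.lift' rank hinj
  let iso : Fin n ≃o V := Fintype.orderIsoFinOfCardEq V hn
  have hle : ∀ x y : Fin n, x ≤ y → rank (iso x) ≤ rank (iso y) := fun x y hxy => iso.monotone hxy
  have hint : ∀ e : Sym2 (Fin n), ∃ lo hi : Fin (n + 1),
      (if e.map iso ∈ τ then iso ⁻¹' D (e.map iso) else ∅) =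
        {v : Fin n | (lo : ℕ) ≤ v ∧ (v : ℕ) < hi} := by
    intro e
    apply exists_interval_of_convex
    split_ifs with he
    · exact fun x hx z hz y hxy hyz =>
        h.convex _ he _ hx _ hz _ (Set.mem_univ _) (hle _ _ hxy) (hle _ _ hyz)
    · simp
  choose lo hi hlohi using hint
  have hind : ∀ e, e.map iso ∈ τ →
      intervalIndicator (lo e) (hi e) = cutIndicator (D (e.map iso)) ∘ iso := by
    intro e he
    rw [intervalIndicator, ← hlohi e, if_pos he]
    rfl
  have hmap : ∀ e e' : Sym2 (Fin n), e.map iso = e'.map iso ↔ e = e' :=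
    fun e e' => (Sym2.map.injective iso.injective).eq_iff
  refine ⟨iso.symm.toEquiv, lo, hi, {e | e.map iso ∈ τ}, ?_, ?_, ?_, ?_⟩
  · intro e he
    have := h.mem_edgeSet _ he
    induction e using Sym2.ind with
    | _ x y => exact this
  · intro e he
    have he' : e.map iso ∉ τ := he
    rw [intervalIndicator, ← hlohi e, if_neg he']
    exact Set.indicator_empty _
  · intro e he e' he'
    rw [hind e he, coboundary_comp, h.separates _ he _ he', ne_eq, hmap]
  · intro χ hχ x y hr
    have hspan := h.spans (χ ∘ iso.symm) (fun e he => by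
      rw [coboundary_comp]
      apply hχ
      rw [Set.mem_ofPred_eq, Sym2.map_map]
      simpa using he) (iso x) trivial (iso y) trivial
      (hr.map (⟨iso, fun hab => hab⟩ : G.comap iso →g G))
    simpa using hspan

/-- Subtracting from `χ` its combination of fundamental cuts leaves a function whose coboundary
vanishes on the forest, because each fundamental cut contains exactly one forest edge. Such a
function is constant on the components of `G`. -/
theorem HasIntervalCuts.coboundary_eq_sum {n : ℕ} {G : SimpleGraph (Fin n)}
    {lo hi : Sym2 (Fin n) → Fin (n + 1)} {τ : Set (Sym2 (Fin n))} (h : HasIntervalCuts G lo hi τ)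
    (χ : Fin n → ZMod 2) (F : Finset (Sym2 (Fin n)))
    (hF : ∀ e ∈ τ, e ∉ F → coboundary χ e = 0) (x y : Fin n) (hxy : G.Reachable x y) :
    χ x + χ y = ∑ e ∈ F, coboundary χ e *
      (intervalIndicator (lo e) (hi e) x + intervalIndicator (lo e) (hi e) y) := by
  set ψ : Fin n → ZMod 2 :=
    χ - ∑ e ∈ F, coboundary χ e • intervalIndicator (lo e) (hi e) with hψ
  have hzero : ∀ e' ∈ τ, coboundary ψ e' = 0 := by
    intro e' he'
    rw [hψ, map_sub, map_sum, Pi.sub_apply, Finset.sum_apply, sub_eq_zero]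
    simp only [map_smul, Pi.smul_apply, smul_eq_mul]
    have hterm : ∀ e ∈ F, e ≠ e' →
        coboundary χ e * coboundary (intervalIndicator (lo e) (hi e)) e' = 0 := by
      intro e _ hne
      by_cases he : e ∈ τ
      · rw [(h.separates e he e' he').2 hne, mul_zero]
      · rw [h.eq_zero e he, map_zero, Pi.zero_apply, mul_zero]
    by_cases heF : e' ∈ F
    · rw [Finset.sum_eq_single_of_mem e' heF hterm]
      have hone : coboundary (intervalIndicator (lo e') (hi e')) e' = 1 :=
        Fin.eq_one_of_ne_zero _ fun h0 => (h.separates e' he' e' he').1 h0 rfl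
      rw [hone, mul_one]
    · rw [hF e' he' heF, Finset.sum_eq_zero]
      intro e he
      exact hterm e he (fun h' => heF (h' ▸ he))
  have := h.spans ψ hzero x y hxy
  have h2 : χ x - χ y = ∑ e ∈ F, coboundary χ e * intervalIndicator (lo e) (hi e) x
      - ∑ e ∈ F, coboundary χ e * intervalIndicator (lo e) (hi e) y := by
    simp only [hψ, Pi.sub_apply, Finset.sum_apply, Pi.smul_apply, smul_eq_mul] at this
    linear_combination this
  rw [CharTwo.sub_eq_add, CharTwo.sub_eq_add, ← Finset.sum_add_distrib] at h2
  rw [h2]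
  exact Finset.sum_congr rfl fun e _ => (mul_add _ _ _).symm

/-! ### Sampling edges at geometric rates -/

/-- The sets `B i` may overlap, so the events are not independent; the coordinates of `ω` are. At
each coordinate only the strongest constraint is kept. At most two sets compete there, which costs a
factor 2 in the exponent. -/
theorem card_filter_forall_le {α ι : Type*} [Fintype α] [DecidableEq α] (M : ℕ)
    (B : ι → Finset α) (Z : Finset ι) (q : ι → ℕ) (hq : ∀ i ∈ Z, q i ≤ M)
    (hB : ∀ a, (Z.filter (a ∈ B ·)).card ≤ 2) :
    (((Finset.univ : Finset (α → Fin M)).filter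
      fun ω => ∀ i ∈ Z, ∀ a ∈ B i, q i ≤ ω a).card : ℝ) ≤
      (M : ℝ) ^ Fintype.card α * Real.exp (-∑ i ∈ Z, ((B i).card * q i / (2 * M) : ℝ)) := by
  classical
  have hpi : ((Finset.univ : Finset (α → Fin M)).filter
      fun ω => ∀ i ∈ Z, ∀ a ∈ B i, q i ≤ ω a) =
      Fintype.piFinset fun a => (Finset.univ : Finset (Fin M)).filter
        fun x : Fin M => ∀ i ∈ Z, a ∈ B i → q i ≤ x := by
    ext ω
    simp only [Finset.mem_filter, Finset.mem_univ, true_and, Fintype.mem_piFinset]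
    exact ⟨fun h a i hi ha => h i hi a ha, fun h i hi a ha => h a i hi ha⟩
  have hone : ∀ a, (((Finset.univ : Finset (Fin M)).filter
      fun x : Fin M => ∀ i ∈ Z, a ∈ B i → q i ≤ x).card : ℝ) ≤
      M * Real.exp (-∑ i ∈ Z.filter (a ∈ B ·), (q i / (2 * M) : ℝ)) := by
    intro a
    rcases (Z.filter (a ∈ B ·)).eq_empty_or_nonempty with h0 | hne
    · rw [h0, Finset.sum_empty, neg_zero, Real.exp_zero, mul_one]
      exact_mod_cast (Finset.card_le_univ _).trans_eq (Fintype.card_fin M)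
    · obtain ⟨j, hj, hmax⟩ := Finset.exists_max_image _ q hne
      obtain ⟨hjZ, hja⟩ := Finset.mem_filter.1 hj
      have hqj := hq j hjZ
      have hcard : ((Finset.univ : Finset (Fin M)).filter
          fun x : Fin M => ∀ i ∈ Z, a ∈ B i → q i ≤ x).card ≤ M - q j := by
        calc _ ≤ ((Finset.univ : Finset (Fin M)).filter fun x : Fin M => ¬ (x : ℕ) < q j).card :=
              Finset.card_le_card fun x hx => by
                simp only [Finset.mem_filter, Finset.mem_univ, true_and, not_lt] at hx ⊢
                exact hx j hjZ hja
          _ = M - q j := by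
              rw [Finset.filter_not, Finset.card_sdiff_of_subset (Finset.filter_subset _ _),
                Fin.card_filter_val_lt, Finset.card_univ, Fintype.card_fin, min_eq_right hqj]
      rcases Nat.eq_zero_or_pos M with rfl | hM
      · simp
      have hM' : (0 : ℝ) < M := by exact_mod_cast hM
      have hsum : ∑ i ∈ Z.filter (a ∈ B ·), (q i / (2 * M) : ℝ) ≤ q j / M := by
        calc _ ≤ ∑ _i ∈ Z.filter (a ∈ B ·), (q j / (2 * M) : ℝ) :=
              Finset.sum_le_sum fun i hi => by
                have : (q i : ℝ) ≤ q j := by exact_mod_cast hmax i hi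
                gcongr
          _ = (Z.filter (a ∈ B ·)).card * (q j / (2 * M) : ℝ) := by simp
          _ ≤ 2 * (q j / (2 * M) : ℝ) := by
              have : ((Z.filter (a ∈ B ·)).card : ℝ) ≤ 2 := by exact_mod_cast hB a
              gcongr
          _ = q j / M := by field_simp
      calc _ ≤ ((M - q j : ℕ) : ℝ) := by exact_mod_cast hcard
        _ = M * (1 - q j / M) := by rw [Nat.cast_sub hqj]; field_simp
        _ ≤ M * Real.exp (-(q j / M)) := by gcongr; exact Real.one_sub_le_exp_neg _
        _ ≤ _ := by gcongr
  rw [hpi, Fintype.card_piFinset, Nat.cast_prod]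
  calc _ ≤ ∏ a, (M * Real.exp (-∑ i ∈ Z.filter (a ∈ B ·), (q i / (2 * M) : ℝ))) :=
        Finset.prod_le_prod (fun _ _ => Nat.cast_nonneg _) fun a _ => hone a
    _ = _ := by
        rw [Finset.prod_mul_distrib, ← Real.exp_sum, Finset.prod_const, Finset.card_univ,
          Finset.sum_neg_distrib]
        simp only [Finset.sum_filter]
        rw [Finset.sum_comm]
        congr 3
        refine Finset.sum_congr rfl fun i _ => ?_
        rw [← Finset.sum_filter, Finset.sum_const, nsmul_eq_mul]
        simp only [Finset.filter_univ_mem]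
        ring

/-- A Chernoff bound: Markov's inequality for `2 ^ hits`, whose mean factors over the coordinates
even though the sets overlap. -/
theorem card_filter_le_sum_hits {α ι : Type*} [Fintype α] [DecidableEq α] (M : ℕ) (hM : 0 < M)
    (B : ι → Finset α) (I : Finset ι) (q : ι → ℕ)
    (hB : ∀ a, (I.filter (a ∈ B ·)).card ≤ 2) (t : ℕ) :
    (((Finset.univ : Finset (α → Fin M)).filter
      fun ω => t ≤ ∑ i ∈ I, ((B i).filter fun a => (ω a : ℕ) < q i).card).card : ℝ) * 2 ^ t ≤
      (M : ℝ) ^ Fintype.card α * Real.exp (2 * ∑ i ∈ I, ((B i).card * q i / M : ℝ)) := by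
  classical
  have hM' : (0 : ℝ) < M := by exact_mod_cast hM
  obtain ⟨c, hc⟩ : ∃ c : α → Fin M → ℕ,
      ∀ a x, c a x = (I.filter fun i => a ∈ B i ∧ (x : ℕ) < q i).card := ⟨_, fun _ _ => rfl⟩
  have hsum : ∀ ω : α → Fin M,
      ∑ i ∈ I, ((B i).filter fun a => (ω a : ℕ) < q i).card = ∑ a, c a (ω a) := by
    intro ω
    simp only [hc, Finset.card_filter]
    rw [Finset.sum_comm]
    refine Finset.sum_congr rfl fun i _ => ?_
    rw [← Finset.sum_filter, ← Finset.sum_filter, Finset.filter_and]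
    congr 1
    ext; simp
  have hc2 : ∀ a x, c a x ≤ 2 := fun a x => (hc a x).trans_le <|
    (Finset.card_le_card (Finset.monotone_filter_right _ fun i _ h => h.1)).trans (hB a)
  have hone : ∀ a, ∑ x, (2 : ℝ) ^ c a x ≤
      M * Real.exp (2 * ∑ i ∈ I.filter (a ∈ B ·), (q i / M : ℝ)) := by
    intro a
    -- This linear bound on the exponential holds because a coordinate counts at most twice; its
    -- mean then follows from the mean number of hits.
    have hpow : ∀ x, (2 : ℝ) ^ c a x ≤ 1 + 2 * c a x := by
      intro x
      have := hc2 a x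
      interval_cases c a x <;> norm_num
    have hcs : ∑ x, (c a x : ℝ) ≤ ∑ i ∈ I.filter (a ∈ B ·), (q i : ℝ) := by
      simp only [hc, Finset.card_filter, Nat.cast_sum]
      rw [Finset.sum_comm, Finset.sum_filter]
      refine Finset.sum_le_sum fun i _ => ?_
      split_ifs with h
      · simp only [h, true_and]
        rw [← Nat.cast_sum, ← Finset.card_filter, Fin.card_filter_val_lt]
        exact_mod_cast min_le_right _ _
      · simp [h]
    calc _ ≤ ∑ x, (1 + 2 * c a x : ℝ) := Finset.sum_le_sum fun x _ => hpow x
      _ = M + 2 * ∑ x, (c a x : ℝ) := by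
          rw [Finset.sum_add_distrib, ← Finset.mul_sum, Finset.sum_const, Finset.card_univ,
            Fintype.card_fin, nsmul_eq_mul, mul_one]
      _ ≤ M + 2 * ∑ i ∈ I.filter (a ∈ B ·), (q i : ℝ) := by gcongr
      _ = M * (2 * ∑ i ∈ I.filter (a ∈ B ·), (q i / M : ℝ) + 1) := by
          rw [← Finset.sum_div]; field_simp; ring
      _ ≤ _ := by gcongr; exact Real.add_one_le_exp _
  calc _ = ∑ ω ∈ (Finset.univ : Finset (α → Fin M)).filter
          fun ω => t ≤ ∑ i ∈ I, ((B i).filter fun a => (ω a : ℕ) < q i).card, (2 : ℝ) ^ t := by simp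
    _ ≤ ∑ ω ∈ (Finset.univ : Finset (α → Fin M)).filter
          fun ω => t ≤ ∑ i ∈ I, ((B i).filter fun a => (ω a : ℕ) < q i).card,
          ∏ a, (2 : ℝ) ^ c a (ω a) := by
        refine Finset.sum_le_sum fun ω hω => ?_
        rw [Finset.prod_pow_eq_pow_sum, ← hsum]
        exact pow_le_pow_right₀ one_le_two (Finset.mem_filter.1 hω).2
    _ ≤ ∑ ω : α → Fin M, ∏ a, (2 : ℝ) ^ c a (ω a) :=
        Finset.sum_le_sum_of_subset_of_nonneg (Finset.filter_subset _ _)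
          fun _ _ _ => by positivity
    _ = ∏ a, ∑ x, (2 : ℝ) ^ c a x :=
        (Fintype.prod_sum fun a (x : Fin M) => (2 : ℝ) ^ c a x).symm
    _ ≤ ∏ a, (M * Real.exp (2 * ∑ i ∈ I.filter (a ∈ B ·), (q i / M : ℝ))) :=
        Finset.prod_le_prod (fun _ _ => by positivity) fun a _ => hone a
    _ = _ := by
        rw [Finset.prod_mul_distrib, ← Real.exp_sum, Finset.prod_const, Finset.card_univ,
          ← Finset.mul_sum]
        simp only [Finset.sum_filter]
        rw [Finset.sum_comm]
        congr 3
        refine Finset.sum_congr rfl fun i _ => ?_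
        rw [← Finset.sum_filter, Finset.sum_const, nsmul_eq_mul]
        simp only [Finset.filter_univ_mem]
        ring

/-- At this level the expected number of sampled elements among `d` lies between 16 and 32; the
least level reaching 16 cannot overshoot by more than a factor 2. -/
theorem exists_sampling_level {J d : ℕ} (hd : d ≤ 2 ^ J) (h16 : 16 < d) :
    ∃ j ≤ J, 16 * 2 ^ J ≤ d * 2 ^ j ∧ d * 2 ^ j ≤ 32 * 2 ^ J := by
  have hex : ∃ j, 16 * 2 ^ J ≤ d * 2 ^ j := ⟨J, Nat.mul_le_mul_right _ h16.le⟩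
  classical
  refine ⟨Nat.find hex, Nat.find_min' hex (Nat.mul_le_mul_right _ h16.le), Nat.find_spec hex, ?_⟩
  rcases h : Nat.find hex with _ | j
  · have : 1 ≤ 2 ^ J := Nat.one_le_two_pow
    simp only [pow_zero, mul_one]; omega
  · have := Nat.find_min hex (m := j) (by omega)
    rw [pow_succ]
    push Not at this
    linarith

/-- Sampling at all rates `1, 1/2, 1/4, …`: if every element lies in at most two of `k` nonempty
sets, then all but an exponentially small fraction of the samplings hit at least half of the sets
in at least one and at most `512` elements at some rate. -/
theorem card_filter_few_sampled_le {α ι : Type*} [Fintype α] [DecidableEq α] (J : ℕ)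
    (B : ι → Finset α) (I : Finset ι) (hB : ∀ a, (I.filter (a ∈ B ·)).card ≤ 2)
    (hne : ∀ i ∈ I, (B i).Nonempty) (hcard : ∀ i ∈ I, (B i).card ≤ 2 ^ J)
    (good : (α → Fin (2 ^ J)) → ι → Prop)
    (hgood : ∀ ω, ∀ i ∈ I, ∀ j ≤ J, ((B i).filter fun a => (ω a : ℕ) < 2 ^ j).Nonempty →
      ((B i).filter fun a => (ω a : ℕ) < 2 ^ j).card ≤ 512 → good ω i) :
    (Nat.card {ω : α → Fin (2 ^ J) // ∃ S ⊆ I, (∀ i ∈ S, ¬ good ω i) ∧ I.card < 2 * S.card} : ℝ) *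
      2 ^ I.card ≤ 2 * ((2 ^ J : ℕ) : ℝ) ^ Fintype.card α := by
  classical
  have hM : 0 < 2 ^ J := by positivity
  have hlev : ∀ i, ∃ j, i ∈ I → 16 < (B i).card →
      j ≤ J ∧ 16 * 2 ^ J ≤ (B i).card * 2 ^ j ∧ (B i).card * 2 ^ j ≤ 32 * 2 ^ J := by
    intro i
    by_cases hi : i ∈ I ∧ 16 < (B i).card
    · obtain ⟨j, h⟩ := exists_sampling_level (hcard i hi.1) hi.2
      exact ⟨j, fun _ _ => h⟩
    · exact ⟨0, fun h1 h2 => absurd ⟨h1, h2⟩ hi⟩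
  choose l hl using hlev
  set I' := I.filter fun i => 16 < (B i).card with hI'
  have hlI : ∀ i ∈ I', l i ≤ J ∧ 16 * 2 ^ J ≤ (B i).card * 2 ^ l i ∧
      (B i).card * 2 ^ l i ≤ 32 * 2 ^ J := fun i hi =>
    hl i (Finset.mem_filter.1 hi).1 (Finset.mem_filter.1 hi).2
  have hI'I : I' ⊆ I := Finset.filter_subset _ _
  set zeroEv : Finset ι → Finset (α → Fin (2 ^ J)) := fun Z =>
    Finset.univ.filter fun ω => ∀ i ∈ Z, ∀ a ∈ B i, 2 ^ l i ≤ (ω a : ℕ) with hzeroEv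
  set overEv : Finset (α → Fin (2 ^ J)) := Finset.univ.filter fun ω =>
    128 * I.card ≤ ∑ i ∈ I', ((B i).filter fun a => (ω a : ℕ) < 2 ^ l i).card with hoverEv
  set Zs := I'.powerset.filter fun Z => I.card ≤ 4 * Z.card with hZs
  -- Sets of at most 16 elements are good already at the full rate. If more than half of the sets
  -- are not good, then at their chosen levels either a quarter of all sets are missed entirely, or
  -- more than a quarter receive over 512 hits each, hence at least `128 * I.card` hits in total.
  have hsub : (Finset.univ.filter fun ω => ∃ S ⊆ I, (∀ i ∈ S, ¬ good ω i) ∧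
      I.card < 2 * S.card) ⊆ Zs.biUnion zeroEv ∪ overEv := by
    intro ω hω
    obtain ⟨S, hSI, hS, hk⟩ := (Finset.mem_filter.1 hω).2
    have hS' : ∀ i ∈ S, i ∈ I' := by
      intro i hi
      by_contra hi'
      have hsmall : (B i).card ≤ 16 := by
        by_contra h
        exact hi' (Finset.mem_filter.2 ⟨hSI hi, by omega⟩)
      have hall : ((B i).filter fun a => (ω a : ℕ) < 2 ^ J) = B i :=
        Finset.filter_true_of_mem fun a _ => (ω a).2
      refine hS i hi (hgood ω i (hSI hi) J le_rfl ?_ ?_)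
      · rw [hall]; exact hne i (hSI hi)
      · rw [hall]; omega
    set Z := S.filter fun i => ∀ a ∈ B i, 2 ^ l i ≤ (ω a : ℕ) with hZ
    set O := S.filter fun i => ¬ ∀ a ∈ B i, 2 ^ l i ≤ (ω a : ℕ) with hO
    have hZO : Z.card + O.card = S.card := Finset.card_filter_add_card_filter_not _
    by_cases h4 : I.card ≤ 4 * Z.card
    · refine Finset.mem_union_left _ (Finset.mem_biUnion.2 ⟨Z, ?_, ?_⟩)
      · exact Finset.mem_filter.2 ⟨Finset.mem_powerset.2 fun i hi =>
          hS' i (Finset.mem_filter.1 hi).1, h4⟩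
      · exact Finset.mem_filter.2 ⟨Finset.mem_univ _, fun i hi => (Finset.mem_filter.1 hi).2⟩
    · refine Finset.mem_union_right _ (Finset.mem_filter.2 ⟨Finset.mem_univ _, ?_⟩)
      have hover : ∀ i ∈ O, 512 ≤ ((B i).filter fun a => (ω a : ℕ) < 2 ^ l i).card := by
        intro i hi
        obtain ⟨hiS, hi0⟩ := Finset.mem_filter.1 hi
        push Not at hi0
        obtain ⟨a, ha, hlt⟩ := hi0
        by_contra hlt'
        exact hS i hiS (hgood ω i (hSI hiS) (l i) (hlI i (hS' i hiS)).1
          ⟨a, Finset.mem_filter.2 ⟨ha, hlt⟩⟩ (by omega))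
      calc 128 * I.card ≤ O.card * 512 := by omega
        _ ≤ ∑ i ∈ O, ((B i).filter fun a => (ω a : ℕ) < 2 ^ l i).card :=
            Finset.card_nsmul_le_sum _ _ _ hover
        _ ≤ _ := Finset.sum_le_sum_of_subset fun i hi => hS' i (Finset.mem_filter.1 hi).1
  have hcast : ∀ i ∈ I', (16 : ℝ) ≤ (B i).card * (2 ^ l i : ℕ) / (2 ^ J : ℕ) ∧
      ((B i).card * (2 ^ l i : ℕ) / (2 ^ J : ℕ) : ℝ) ≤ 32 := by
    intro i hi
    obtain ⟨-, h1, h2⟩ := hlI i hi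
    have hM' : (0 : ℝ) < (2 ^ J : ℕ) := by exact_mod_cast hM
    rw [le_div_iff₀ hM', div_le_iff₀ hM']
    exact ⟨by exact_mod_cast h1, by exact_mod_cast h2⟩
  set T : ℝ := ((2 ^ J : ℕ) : ℝ) ^ Fintype.card α with hT
  have hT0 : 0 ≤ T := by positivity
  -- Each set of `Z` contributes `16 / 2 = 8` to the exponent and `Z` has at least a quarter of the
  -- sets, so the fraction is at most `exp (-2 |I|) ≤ 4 ^ (-|I|)`. This beats the at most `2 ^ |I|`
  -- choices of `Z`.
  have hzero : ∀ Z ∈ Zs, ((zeroEv Z).card : ℝ) * 4 ^ I.card ≤ T := by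
    intro Z hZ
    obtain ⟨hZI, hZ4⟩ := Finset.mem_filter.1 hZ
    have hZI' := Finset.mem_powerset.1 hZI
    have h := card_filter_forall_le (2 ^ J) B Z (fun i => 2 ^ l i)
      (fun i hi => Nat.pow_le_pow_right two_pos (hlI i (hZI' hi)).1)
      fun a => (Finset.card_le_card (Finset.filter_subset_filter _ (hZI'.trans hI'I))).trans (hB a)
    have hexp : (2 * I.card : ℝ) ≤
        ∑ i ∈ Z, ((B i).card * (2 ^ l i : ℕ) / (2 * (2 ^ J : ℕ)) : ℝ) := by
      calc (2 * I.card : ℝ) ≤ Z.card * 8 := by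
            have : (I.card : ℝ) ≤ 4 * Z.card := by exact_mod_cast hZ4
            linarith
        _ = ∑ _i ∈ Z, (8 : ℝ) := by rw [Finset.sum_const, nsmul_eq_mul]
        _ ≤ _ := Finset.sum_le_sum fun i hi => by
            have := (hcast i (hZI' hi)).1
            rw [mul_comm (2 : ℝ), ← div_div]
            linarith
    have h4 : (4 : ℝ) ^ I.card ≤ Real.exp (2 * I.card) := by
      rw [mul_comm, Real.exp_nat_mul]
      have : (4 : ℝ) ≤ Real.exp 2 := by
        have := Real.add_one_le_exp (1 : ℝ)
        calc (4 : ℝ) = 2 * 2 := by norm_num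
          _ ≤ Real.exp 1 * Real.exp 1 := by gcongr <;> linarith
          _ = Real.exp 2 := by rw [← Real.exp_add]; norm_num
      gcongr
    calc ((zeroEv Z).card : ℝ) * 4 ^ I.card
        ≤ (T * Real.exp (-(2 * I.card))) * Real.exp (2 * I.card) := by
          refine mul_le_mul (h.trans ?_) h4 (by positivity) (by positivity)
          rw [← hT]
          gcongr
      _ = T := by rw [mul_assoc, ← Real.exp_add]; simp
  have hover : (overEv.card : ℝ) * 2 ^ I.card ≤ T := by
    have h := card_filter_le_sum_hits (2 ^ J) hM B I' (fun i => 2 ^ l i)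
      (fun a => (Finset.card_le_card (Finset.filter_subset_filter _ hI'I)).trans (hB a))
      (128 * I.card)
    have hexp : 2 * ∑ i ∈ I', ((B i).card * (2 ^ l i : ℕ) / (2 ^ J : ℕ) : ℝ) ≤ I.card * 64 := by
      have h1 : ∑ i ∈ I', ((B i).card * (2 ^ l i : ℕ) / (2 ^ J : ℕ) : ℝ) ≤ ∑ _i ∈ I', (32 : ℝ) :=
        Finset.sum_le_sum fun i hi => (hcast i hi).2
      rw [Finset.sum_const, nsmul_eq_mul] at h1
      have h2 : (I'.card : ℝ) ≤ I.card := by exact_mod_cast Finset.card_le_card hI'I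
      linarith
    -- Of the `128 |I|` factors 2 from Markov's inequality, `127 |I|` absorb the mean and `|I|` are
    -- left over.
    have h8 : Real.exp (I.card * 64) ≤ ((2 : ℝ) ^ 127) ^ I.card := by
      rw [Real.exp_nat_mul]
      have : Real.exp 64 ≤ 2 ^ 127 := by
        calc Real.exp 64 = Real.exp 1 ^ 64 := by rw [← Real.exp_nat_mul]; norm_num
          _ ≤ (2.8 : ℝ) ^ 64 := by
              have := Real.exp_one_lt_d9
              gcongr
              linarith
          _ ≤ 2 ^ 127 := by norm_num
      gcongr
    have h128 : (2 : ℝ) ^ (128 * I.card) = (2 ^ 127) ^ I.card * 2 ^ I.card := by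
      rw [← mul_pow, pow_mul]; norm_num
    have hpos : (0 : ℝ) < (2 ^ 127) ^ I.card := by positivity
    rw [h128] at h
    have h' := h.trans (mul_le_mul_of_nonneg_left ((Real.exp_le_exp.2 hexp).trans h8) hT0)
    refine le_of_mul_le_mul_right ?_ hpos
    calc _ = (overEv.card : ℝ) * ((2 ^ 127) ^ I.card * 2 ^ I.card) := by ring
      _ ≤ _ := h'
  have hZcard : (Zs.card : ℝ) ≤ 2 ^ I.card := by
    have : Zs.card ≤ 2 ^ I.card :=
      (Finset.card_le_card (Finset.filter_subset _ _)).trans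
        ((Finset.card_powerset _).trans_le
          (Nat.pow_le_pow_right two_pos (Finset.card_le_card hI'I)))
    exact_mod_cast this
  rw [Nat.card_eq_fintype_card, Fintype.card_subtype]
  have h2pos : (0 : ℝ) < 2 ^ I.card := by positivity
  calc _ ≤ ((∑ Z ∈ Zs, (zeroEv Z).card + overEv.card : ℕ) : ℝ) * 2 ^ I.card := by
        gcongr
        exact (Finset.card_le_card hsub).trans
          ((Finset.card_union_le _ _).trans (Nat.add_le_add_right Finset.card_biUnion_le _))
    _ = (∑ Z ∈ Zs, ((zeroEv Z).card : ℝ) * 4 ^ I.card) / 2 ^ I.card +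
          overEv.card * 2 ^ I.card := by
        push_cast
        rw [add_mul, ← Finset.sum_mul]
        congr 1
        rw [eq_div_iff h2pos.ne', mul_assoc, ← mul_pow]
        norm_num
    _ ≤ (∑ _Z ∈ Zs, T) / 2 ^ I.card + T := by
        gcongr with Z hZ
        exact hzero Z hZ
    _ ≤ (2 ^ I.card * T) / 2 ^ I.card + T := by
        rw [Finset.sum_const, nsmul_eq_mul]
        gcongr
    _ = 2 * T := by field_simp; ring

/-! ### Finite uniform probability -/

/-- The probability of an event under the uniform distribution on a finite type. -/
noncomputable def freq {Ω : Type*} (P : Ω → Prop) : ℝ := Nat.card {ω // P ω} / Nat.card Ω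

theorem freq_nonneg {Ω : Type*} (P : Ω → Prop) : 0 ≤ freq P := by unfold freq; positivity

theorem freq_mono {Ω : Type*} [Finite Ω] {P Q : Ω → Prop} (h : ∀ ω, P ω → Q ω) :
    freq P ≤ freq Q := by
  unfold freq
  gcongr
  exact Nat.card_le_card_of_injective (Subtype.map id h) (Subtype.map_injective h
    Function.injective_id)

theorem freq_or_le {Ω : Type*} [Finite Ω] (P Q : Ω → Prop) :
    freq (fun ω => P ω ∨ Q ω) ≤ freq P + freq Q := by
  classical
  cases nonempty_fintype Ω
  unfold freq
  rw [← add_div]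
  gcongr
  simp only [Nat.card_eq_fintype_card, Fintype.card_subtype]
  rw [Finset.filter_or]
  exact_mod_cast Finset.card_union_le _ _

theorem freq_exists_mem_le {Ω ι : Type*} [Finite Ω] (s : Finset ι) (P : ι → Ω → Prop) {ε : ℝ}
    (h : ∀ i ∈ s, freq (P i) ≤ ε) : freq (fun ω => ∃ i ∈ s, P i ω) ≤ s.card * ε := by
  classical
  induction s using Finset.induction_on with
  | empty => simp [freq]
  | insert a s ha ih =>
    calc freq (fun ω => ∃ i ∈ insert a s, P i ω)
        ≤ freq (fun ω => P a ω ∨ ∃ i ∈ s, P i ω) := freq_mono fun ω => by simp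
      _ ≤ freq (P a) + freq fun ω => ∃ i ∈ s, P i ω := freq_or_le _ _
      _ ≤ ε + s.card * ε := add_le_add (h a (Finset.mem_insert_self a s))
          (ih fun i hi => h i (Finset.mem_insert_of_mem hi))
      _ = (insert a s).card * ε := by
          rw [Finset.card_insert_of_notMem ha]; push_cast; ring

theorem freq_exists_le {Ω ι : Type*} [Finite Ω] [Fintype ι] (P : ι → Ω → Prop) {ε : ℝ}
    (h : ∀ i, freq (P i) ≤ ε) : freq (fun ω => ∃ i, P i ω) ≤ Fintype.card ι * ε := by
  simpa using freq_exists_mem_le Finset.univ P fun i _ => h i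

theorem freq_equiv {Ω Ω' : Type*} (f : Ω ≃ Ω') (P : Ω' → Prop) :
    freq (fun ω => P (f ω)) = freq P := by
  unfold freq
  rw [Nat.card_congr f, Nat.card_congr (f.subtypeEquiv fun _ => Iff.rfl)]

theorem freq_prod_le {A B : Type*} [Finite A] [Finite B] (P : A × B → Prop) {ε : ℝ} (hε : 0 ≤ ε)
    (h : ∀ a, freq (fun b => P (a, b)) ≤ ε) : freq P ≤ ε := by
  classical
  cases nonempty_fintype A
  cases nonempty_fintype B
  unfold freq at h ⊢
  rcases isEmpty_or_nonempty (A × B) with hAB | hAB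
  · simpa using hε
  have hA : Nonempty A := hAB.map Prod.fst
  have hB : Nonempty B := hAB.map Prod.snd
  have hA' : (0 : ℝ) < Fintype.card A := by exact_mod_cast Fintype.card_pos
  have hB' : (0 : ℝ) < Fintype.card B := by exact_mod_cast Fintype.card_pos
  simp only [Nat.card_eq_fintype_card] at h ⊢
  rw [Fintype.card_prod, Nat.cast_mul, div_le_iff₀ (by positivity)]
  rw [Fintype.card_congr (Equiv.subtypeProdEquivSigmaSubtype fun a b => P (a, b)),
    Fintype.card_sigma, Nat.cast_sum]
  calc _ ≤ ∑ _a : A, ε * Fintype.card B := Finset.sum_le_sum fun a _ => by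
        have := h a
        rwa [div_le_iff₀ hB'] at this
    _ = _ := by rw [Finset.sum_const, Finset.card_univ, nsmul_eq_mul]; ring

theorem freq_fst_le {A B : Type*} [Finite A] [Finite B] (P : A → Prop) :
    freq (fun ab : A × B => P ab.1) ≤ freq P := by
  rw [← freq_equiv (Equiv.prodComm B A)]
  exact freq_prod_le _ (freq_nonneg _) fun _ => le_rfl

/-- Conditioning on all coordinates but one. In the application the other coordinates fix the
partition on which round `i` acts. -/
theorem freq_pi_le {ι Ω : Type*} [Finite ι] [DecidableEq ι] [Finite Ω] (P : (ι → Ω) → Prop)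
    (i : ι) {ε : ℝ} (hε : 0 ≤ ε) (h : ∀ ω, freq (fun y => P (Function.update ω i y)) ≤ ε) :
    freq P ≤ ε := by
  rcases isEmpty_or_nonempty Ω with hΩ | ⟨⟨y₀⟩⟩
  · have : IsEmpty (ι → Ω) := ⟨fun ω => hΩ.elim (ω i)⟩
    simpa [freq] using hε
  rw [← freq_equiv (Equiv.funSplitAt i Ω).symm, ← freq_equiv (Equiv.prodComm _ _)]
  refine freq_prod_le _ hε fun ω' => ?_
  refine (freq_mono fun y hy => ?_).trans (h ((Equiv.funSplitAt i Ω).symm (y₀, ω')))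
  convert hy using 1
  ext j
  by_cases hj : j = i
  · subst hj; simp [Equiv.funSplitAt, Equiv.piSplitAt]
  · simp [Equiv.funSplitAt, Equiv.piSplitAt, hj]

/-! ### Polynomial fingerprints -/

/-- The fingerprint of a finite set: its generating polynomial, evaluated at `z`. -/
noncomputable def fingerprint {K β : Type*} [Field K] [Fintype β] (z : K) (X : Finset β) : K :=
  ∑ e ∈ X, z ^ (Fintype.equivFin β e : ℕ)

/-- A collision is a root of the difference of the two generating polynomials, which is nonzero and
of degree below `Fintype.card β`. -/
theorem freq_fingerprint_eq_le {K β : Type*} [Field K] [Finite K] [Fintype β] {X Y : Finset β}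
    (hXY : X ≠ Y) :
    freq (fun z : K => fingerprint z X = fingerprint z Y) ≤ Fintype.card β / Nat.card K := by
  classical
  cases nonempty_fintype K
  unfold freq
  gcongr
  set p : Finset β → Polynomial K := fun X => ∑ e ∈ X, Polynomial.X ^ (Fintype.equivFin β e : ℕ)
    with hp
  have hcoeff : ∀ X e, (p X).coeff (Fintype.equivFin β e : ℕ) = if e ∈ X then 1 else 0 := by
    intro X e
    simp only [hp, Polynomial.finsetSum_coeff, Polynomial.coeff_X_pow, Fin.val_inj,
      EmbeddingLike.apply_eq_iff_eq, Finset.sum_ite_eq]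
  have hdeg : ∀ X, (p X).degree < (Fintype.card β : ℕ) := fun X =>
    (Polynomial.degree_sum_le _ _).trans_lt <| (Finset.sup_lt_iff (WithBot.bot_lt_coe _)).2
      fun e _ => by
        rw [Polynomial.degree_X_pow]
        exact_mod_cast (Fintype.equivFin β e).2
  have hne : p X - p Y ≠ 0 := by
    intro h0
    apply hXY
    ext e
    have := congrArg (fun q => q.coeff (Fintype.equivFin β e : ℕ)) h0
    simp only [Polynomial.coeff_sub, hcoeff, Polynomial.coeff_zero] at this
    by_cases h1 : e ∈ X <;> by_cases h2 : e ∈ Y <;> simp_all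
  have hroots : (p X - p Y).roots.card ≤ Fintype.card β := by
    have h1 := Polynomial.card_roots hne
    have h2 := (Polynomial.degree_sub_le (p X) (p Y)).trans (max_le (hdeg X).le (hdeg Y).le)
    exact_mod_cast h1.trans h2
  refine le_trans ?_ hroots
  rw [Nat.card_eq_fintype_card, Fintype.card_subtype]
  refine (Finset.card_le_card fun z hz => ?_).trans (Multiset.toFinset_card_le _)
  rw [Multiset.mem_toFinset, Polynomial.mem_roots hne, Polynomial.IsRoot, Polynomial.eval_sub]
  have hz' : fingerprint z X = fingerprint z Y := (Finset.mem_filter.1 hz).2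
  simp only [hp, Polynomial.eval_finsetSum, Polynomial.eval_pow, Polynomial.eval_X]
  exact sub_eq_zero.2 hz'

theorem card_finset_card_le {β : Type*} [Fintype β] (s : ℕ) :
    Nat.card {X : Finset β // X.card ≤ s} ≤ (Fintype.card β + 1) ^ s := by
  classical
  have hsurj : Function.Surjective fun g : Fin s → Option β =>
      (⟨(Finset.univ.image g).eraseNone, by
        refine (Finset.card_eraseNone_le _).trans (Finset.card_image_le.trans ?_)
        simp⟩ : {X : Finset β // X.card ≤ s}) := by
    rintro ⟨X, hX⟩
    refine ⟨fun i => X.toList[(i : ℕ)]?, Subtype.ext ?_⟩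
    ext e
    simp only [Finset.mem_eraseNone, Finset.mem_image, Finset.mem_univ, true_and]
    constructor
    · rintro ⟨i, hi⟩
      exact Finset.mem_toList.1 (List.mem_of_getElem? hi)
    · intro he
      obtain ⟨i, hi⟩ := List.mem_iff_getElem?.1 (Finset.mem_toList.2 he)
      have : i < s := by
        have := (List.getElem?_eq_some_iff.1 hi).1
        rw [Finset.length_toList] at this
        omega
      exact ⟨⟨i, this⟩, hi⟩
  refine (Nat.card_le_card_of_surjective _ hsurj).trans ?_
  simp

/-! ### Merging the classes of a partition -/

/-- The indicator function of a class of a partition of the vertices. -/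
noncomputable def classIndicator {V : Type*} (P : Setoid V) (q : Quotient P) : V → ZMod 2 :=
  cutIndicator {v | Quotient.mk P v = q}

theorem le_ker_classIndicator {V : Type*} (P : Setoid V) (q : Quotient P) :
    P ≤ Setoid.ker (classIndicator P q) := by
  intro x y hxy
  rw [Setoid.ker_def, classIndicator, cutIndicator_eq_iff]
  have : Quotient.mk P x = Quotient.mk P y := Quotient.sound hxy
  simp [this]

theorem coboundary_classIndicator_ne_zero {V : Type*} {P : Setoid V} {q : Quotient P} {u v : V}
    (h : coboundary (classIndicator P q) s(u, v) ≠ 0) :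
    Quotient.mk P u ≠ Quotient.mk P v ∧ (q = Quotient.mk P u ∨ q = Quotient.mk P v) := by
  rw [ne_eq, coboundary_mk_eq_zero, classIndicator, cutIndicator_eq_iff] at h
  refine ⟨fun he => h (by simp [he]), ?_⟩
  by_contra hn
  push Not at hn
  exact h (by simp [hn.1.symm, hn.2.symm])

theorem coboundary_classIndicator_mk_ne_zero {V : Type*} {P : Setoid V} {u v : V}
    (h : Quotient.mk P u ≠ Quotient.mk P v) :
    coboundary (classIndicator P (Quotient.mk P u)) s(u, v) ≠ 0 := by
  rw [ne_eq, coboundary_mk_eq_zero, classIndicator, cutIndicator_eq_iff]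
  simp [h.symm]

/-- The classes of a partition that some edge of `H` leaves. -/
noncomputable def activeClasses {V : Type*} [Finite V] (P : Setoid V) (H : Finset (Sym2 V)) :
    Finset (Quotient P) :=
  (Set.toFinite {q | ∃ e ∈ H, coboundary (classIndicator P q) e ≠ 0}).toFinset

theorem mem_activeClasses {V : Type*} [Finite V] {P : Setoid V} {H : Finset (Sym2 V)}
    {q : Quotient P} :
    q ∈ activeClasses P H ↔ ∃ e ∈ H, coboundary (classIndicator P q) e ≠ 0 :=
  Set.Finite.mem_toFinset _

/-- One round of merging: `found χ` is the set of edges found on looking at the class with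
indicator function `χ`, and the end points of every found edge are identified. -/
def mergeStep {V : Type*} (P : Setoid V) (found : (V → ZMod 2) → Sym2 V → Prop) : Setoid V :=
  P ⊔ Relation.EqvGen.setoid fun u v => ∃ q, found (classIndicator P q) s(u, v)

theorem le_mergeStep {V : Type*} (P : Setoid V) (found : (V → ZMod 2) → Sym2 V → Prop) :
    P ≤ mergeStep P found := le_sup_left

theorem mergeStep_rel {V : Type*} {P : Setoid V} {found : (V → ZMod 2) → Sym2 V → Prop}
    {q : Quotient P} {u v : V} (h : found (classIndicator P q) s(u, v)) :
    mergeStep P found u v :=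
  (le_sup_right : _ ≤ mergeStep P found) (Relation.EqvGen.rel _ _ ⟨q, h⟩)

theorem mergeStep_le {V : Type*} {P S : Setoid V} {found : (V → ZMod 2) → Sym2 V → Prop}
    (hP : P ≤ S) (h : ∀ χ u v, found χ s(u, v) → S u v) : mergeStep P found ≤ S :=
  sup_le hP (Setoid.eqvGen_le fun u v ⟨_, hq⟩ => h _ u v hq)

/-- The elements outside `S`, at least half of `A`, are identified at least two to one, so at least
a quarter of `A` disappears. -/
theorem card_image_le_of_not_injective {α β : Type*} [DecidableEq α] [DecidableEq β]
    (A S : Finset α) (f : α → β)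
    (h : ∀ a ∈ A, a ∉ S → ∃ b ∈ A, b ≠ a ∧ f b = f a) (hS : 2 * S.card ≤ A.card) :
    4 * (A.image f).card ≤ 3 * A.card := by
  set M := A.filter fun a => ∃ b ∈ A, b ≠ a ∧ f b = f a with hM
  have hMA : M ⊆ A := Finset.filter_subset _ _
  have hcover : A.image f ⊆ M.image f ∪ (A \ M).image f := by
    rw [← Finset.image_union, Finset.union_sdiff_of_subset hMA]
  have hM2 : 2 * (M.image f).card ≤ M.card := by
    refine Finset.mul_card_image_le_card M 2 fun y hy => ?_
    obtain ⟨a, ha, rfl⟩ := Finset.mem_image.1 hy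
    obtain ⟨haA, b, hb, hba, hfb⟩ := Finset.mem_filter.1 ha
    have hbM : b ∈ M := Finset.mem_filter.2 ⟨hb, a, haA, hba.symm, hfb.symm⟩
    exact Finset.one_lt_card.2 ⟨a, Finset.mem_filter.2 ⟨ha, rfl⟩, b,
      Finset.mem_filter.2 ⟨hbM, hfb⟩, hba.symm⟩
  have hrest : A \ M ⊆ S := by
    intro a ha
    obtain ⟨haA, haM⟩ := Finset.mem_sdiff.1 ha
    by_contra haS
    exact haM (Finset.mem_filter.2 ⟨haA, h a haA haS⟩)
  have h1 := Finset.card_le_card hcover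
  have h2 := Finset.card_union_le (M.image f) ((A \ M).image f)
  have h3 : ((A \ M).image f).card ≤ (A \ M).card := Finset.card_image_le
  have h4 := Finset.card_sdiff_add_card_eq_card hMA
  have h5 := Finset.card_le_card hrest
  omega

theorem activeClasses_mergeStep_subset {V : Type*} [Finite V] (P : Setoid V)
    [DecidableEq (Quotient P)] (H : Finset (Sym2 V)) (found : (V → ZMod 2) → Sym2 V → Prop)
    [DecidableEq (Quotient (mergeStep P found))] :
    activeClasses (mergeStep P found) H ⊆
      (activeClasses P H).image (Quotient.map id (le_mergeStep P found)) := by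
  intro q hq
  obtain ⟨e, he, hqe⟩ := mem_activeClasses.1 hq
  induction e using Sym2.ind with
  | _ u v =>
    obtain ⟨hne, hor⟩ := coboundary_classIndicator_ne_zero hqe
    have hne' : Quotient.mk P u ≠ Quotient.mk P v := fun h' => hne
      (congrArg (Quotient.map id (le_mergeStep P found)) h')
    rcases hor with rfl | rfl
    · exact Finset.mem_image.2 ⟨Quotient.mk P u, mem_activeClasses.2
        ⟨_, he, coboundary_classIndicator_mk_ne_zero hne'⟩, rfl⟩
    · exact Finset.mem_image.2 ⟨Quotient.mk P v, mem_activeClasses.2 ⟨_, he, by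
        rw [Sym2.eq_swap]; exact coboundary_classIndicator_mk_ne_zero hne'.symm⟩, rfl⟩

theorem card_activeClasses_mergeStep_le_self {V : Type*} [Finite V] (P : Setoid V)
    (H : Finset (Sym2 V)) (found : (V → ZMod 2) → Sym2 V → Prop) :
    (activeClasses (mergeStep P found) H).card ≤ (activeClasses P H).card := by
  classical
  exact (Finset.card_le_card (activeClasses_mergeStep_subset P H found)).trans
    Finset.card_image_le

theorem card_activeClasses_mergeStep_le {V : Type*} [Finite V] (P : Setoid V)
    (H : Finset (Sym2 V)) (found : (V → ZMod 2) → Sym2 V → Prop) (S : Finset (Quotient P))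
    (h : ∀ q ∈ activeClasses P H, q ∉ S →
      ∃ e ∈ H, coboundary (classIndicator P q) e ≠ 0 ∧ found (classIndicator P q) e)
    (hS : 2 * S.card ≤ (activeClasses P H).card) :
    4 * (activeClasses (mergeStep P found) H).card ≤ 3 * (activeClasses P H).card := by
  classical
  refine (Nat.mul_le_mul_left 4 (Finset.card_le_card
    (activeClasses_mergeStep_subset P H found))).trans
    (card_image_le_of_not_injective _ S _ ?_ hS)
  intro q hq hqS
  obtain ⟨e, he, hqe, hfound⟩ := h q hq hqS
  induction e using Sym2.ind with
  | _ u v =>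
    have hrel : Quotient.mk (mergeStep P found) u = Quotient.mk (mergeStep P found) v :=
      Quotient.sound (mergeStep_rel hfound)
    obtain ⟨hne, hor⟩ := coboundary_classIndicator_ne_zero hqe
    rcases hor with rfl | rfl
    · refine ⟨Quotient.mk P v, mem_activeClasses.2 ⟨_, he, ?_⟩, hne.symm, hrel.symm⟩
      rw [Sym2.eq_swap]
      exact coboundary_classIndicator_mk_ne_zero hne.symm
    · exact ⟨Quotient.mk P u, mem_activeClasses.2
        ⟨_, he, coboundary_classIndicator_mk_ne_zero hne⟩, hne, hrel⟩

/-- The edges of `H` that `χ` separates. -/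
def cutEdges {V : Type*} (H : Finset (Sym2 V)) (χ : V → ZMod 2) : Finset (Sym2 V) :=
  H.filter fun e => coboundary χ e ≠ 0

/-- The edges of `H` that `χ` separates and that are sampled at rate `2 ^ i / 2 ^ J`. -/
def sampledCut {V : Type*} {J : ℕ} (H : Finset (Sym2 V)) (w : Sym2 V → Fin (2 ^ J)) (i : ℕ)
    (χ : V → ZMod 2) : Finset (Sym2 V) :=
  (cutEdges H χ).filter fun e => (w e : ℕ) < 2 ^ i

/-- The edges that are seen on looking at the sparse sampled cuts of `χ`. -/
def seenEdges {V : Type*} {J : ℕ} (H : Finset (Sym2 V)) (w : Sym2 V → Fin (2 ^ J))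
    (χ : V → ZMod 2) (e : Sym2 V) : Prop :=
  ∃ i : Fin (J + 1), (sampledCut H w i χ).card ≤ 512 ∧ e ∈ sampledCut H w i χ

theorem mem_of_seenEdges {V : Type*} {J : ℕ} {H : Finset (Sym2 V)} {w : Sym2 V → Fin (2 ^ J)}
    {χ : V → ZMod 2} {e : Sym2 V} (h : seenEdges H w χ e) : e ∈ H :=
  let ⟨_, _, hi⟩ := h
  (Finset.mem_filter.1 (Finset.mem_filter.1 hi).1).1

/-- The sampling bound is applied to the cuts of the active classes. An edge leaves at most two
classes, as that bound requires. A class is good if one of its outgoing edges is seen, since that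
edge merges it with another active class. -/
theorem freq_slow_mergeStep_le {V : Type*} [Fintype V] [DecidableEq V] (P : Setoid V)
    (H : Finset (Sym2 V)) (J : ℕ) (hJ : Fintype.card (Sym2 V) ≤ 2 ^ J) :
    freq (fun w : Sym2 V → Fin (2 ^ J) => 3 * (activeClasses P H).card <
      4 * (activeClasses (mergeStep P (seenEdges H w)) H).card) ≤
      2 / 2 ^ (activeClasses P H).card := by
  classical
  have hmain := card_filter_few_sampled_le J (fun q => cutEdges H (classIndicator P q))
    (activeClasses P H) ?_ ?_ ?_
    (fun w q => ∃ e ∈ H, coboundary (classIndicator P q) e ≠ 0 ∧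
      seenEdges H w (classIndicator P q) e) ?_
  · have hpos : (0 : ℝ) < ((2 ^ J : ℕ) : ℝ) ^ Fintype.card (Sym2 V) := by positivity
    unfold freq
    rw [div_le_div_iff₀ (by simp) (by positivity)]
    have hcard : (Nat.card (Sym2 V → Fin (2 ^ J)) : ℝ) =
        ((2 ^ J : ℕ) : ℝ) ^ Fintype.card (Sym2 V) := by
      simp
    rw [hcard]
    refine le_trans ?_ hmain
    gcongr
    refine Nat.card_le_card_of_injective (Subtype.map id ?_) (Subtype.map_injective _
      Function.injective_id)
    intro w hw
    refine ⟨(activeClasses P H).filter fun q => ¬ ∃ e ∈ H,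
      coboundary (classIndicator P q) e ≠ 0 ∧ seenEdges H w (classIndicator P q) e,
      Finset.filter_subset _ _, fun q hq => (Finset.mem_filter.1 hq).2, ?_⟩
    by_contra hcon
    refine absurd (card_activeClasses_mergeStep_le P H (seenEdges H w) _ ?_ (not_lt.1 hcon))
      (not_le.2 hw)
    intro q hq hq'
    by_contra hnot
    exact hq' (Finset.mem_filter.2 ⟨hq, hnot⟩)
  · intro e
    induction e using Sym2.ind with
    | _ u v =>
      refine (Finset.card_le_card fun q hq => ?_).trans
        (Finset.card_le_two (a := Quotient.mk P u) (b := Quotient.mk P v))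
      have := (Finset.mem_filter.1 (Finset.mem_filter.1 hq).2).2
      simpa using (coboundary_classIndicator_ne_zero this).2
  · intro q hq
    obtain ⟨e, he, hqe⟩ := mem_activeClasses.1 hq
    exact ⟨e, Finset.mem_filter.2 ⟨he, hqe⟩⟩
  · exact fun q _ => (Finset.card_le_univ _).trans hJ
  · rintro w q - j hj ⟨e, he⟩ hcard
    obtain ⟨h1, h2⟩ := Finset.mem_filter.1 (Finset.mem_filter.1 he).1
    exact ⟨e, h1, h2, ⟨j, by omega⟩, hcard, he⟩

/-- The partition after a number of rounds of merging. -/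
def mergeRun {V : Type*} {R : ℕ} (P : Setoid V) (found : Fin R → (V → ZMod 2) → Sym2 V → Prop) :
    ℕ → Setoid V
  | 0 => P
  | r + 1 => if h : r < R then mergeStep (mergeRun P found r) (found ⟨r, h⟩) else mergeRun P found r

theorem le_mergeRun {V : Type*} {R : ℕ} (P : Setoid V)
    (found : Fin R → (V → ZMod 2) → Sym2 V → Prop) (r : ℕ) : P ≤ mergeRun P found r := by
  induction r with
  | zero => exact le_rfl
  | succ r ih =>
    rw [mergeRun]
    split_ifs with h
    · exact ih.trans (le_mergeStep _ _)
    · exact ih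

theorem mergeRun_le {V : Type*} {R : ℕ} {P S : Setoid V}
    {found : Fin R → (V → ZMod 2) → Sym2 V → Prop} (hP : P ≤ S)
    (h : ∀ r χ u v, found r χ s(u, v) → S u v) (r : ℕ) : mergeRun P found r ≤ S := by
  induction r with
  | zero => exact hP
  | succ r ih =>
    rw [mergeRun]
    split_ifs with hr
    · exact mergeStep_le ih (h _)
    · exact ih

/-- Agreement is required only on classes that the first run visits. This keeps the union bound over
fingerprints small, and shows that a round depends only on the samples of earlier rounds. -/
theorem mergeRun_congr {V : Type*} {R : ℕ} (P : Setoid V)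
    {found found' : Fin R → (V → ZMod 2) → Sym2 V → Prop} (N : ℕ)
    (h : ∀ r : Fin R, (r : ℕ) < N → ∀ q e,
      found r (classIndicator (mergeRun P found r) q) e ↔
        found' r (classIndicator (mergeRun P found r) q) e) :
    mergeRun P found N = mergeRun P found' N := by
  induction N with
  | zero => rfl
  | succ r ih =>
    have ih' := ih fun i hi => h i (by omega)
    rw [mergeRun, mergeRun, ← ih']
    split_ifs with hr
    · unfold mergeStep
      congr 2
      ext u v
      exact exists_congr fun q => h ⟨r, hr⟩ (by simp) q _
    · rfl

/-! ### Labels, sketches and the decoder -/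

/-- The label of an edge: the edge, the interval of its fundamental cut, and its sketches. -/
abbrev EdgeLabel (n R J : ℕ) (K K' : Type) :=
  Sym2 (Fin n) × (Fin (n + 1) × Fin (n + 1)) × (Fin R × Fin (J + 1) → K) × K'

/-- The label of a vertex: its component, its number, and the evaluation point of the
fingerprints. -/
abbrev VertexLabel (n : ℕ) (K : Type) := Fin n × Fin n × K

/-- The sketch of an edge `e`: the sum of the values of `φ` on its fundamental cut, and `φ e`. -/
noncomputable def edgeSketch {n : ℕ} {K : Type} [AddCommGroup K] [Module (ZMod 2) K]
    (E : Finset (Sym2 (Fin n))) (lo hi : Sym2 (Fin n) → Fin (n + 1)) (φ : Sym2 (Fin n) → K)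
    (e : Sym2 (Fin n)) : K :=
  ∑ g ∈ E, coboundary (intervalIndicator (lo e) (hi e)) g • φ g + φ e

/-- The partition of the vertices by the fundamental cuts of the edges of `F`. -/
noncomputable def cutPartition {n : ℕ} (lo hi : Sym2 (Fin n) → Fin (n + 1))
    (F : Finset (Sym2 (Fin n))) : Setoid (Fin n) :=
  Setoid.ker fun x (e : F) => intervalIndicator (lo e) (hi e) x

theorem cutPartition_rel {n : ℕ} {lo hi : Sym2 (Fin n) → Fin (n + 1)}
    {F : Finset (Sym2 (Fin n))} {x y : Fin n} :
    cutPartition lo hi F x y ↔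
      ∀ e ∈ F, intervalIndicator (lo e) (hi e) x = intervalIndicator (lo e) (hi e) y := by
  rw [cutPartition, Setoid.ker_def, funext_iff, Subtype.forall]

/-- The first summands of the sketches add up to the sum over the whole cut of `χ` in `G`. The
second summands add up to its part in `F`, which cancels in characteristic 2. -/
theorem HasIntervalCuts.sum_edgeSketch {n : ℕ} {G : SimpleGraph (Fin n)}
    {lo hi : Sym2 (Fin n) → Fin (n + 1)} {τ : Set (Sym2 (Fin n))} (h : HasIntervalCuts G lo hi τ)
    {K : Type} [AddCommGroup K] [Module (ZMod 2) K] (E F : Finset (Sym2 (Fin n)))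
    (hE : ∀ e, e ∈ E ↔ e ∈ G.edgeSet) (hF : F ⊆ E) (φ : Sym2 (Fin n) → K) (χ : Fin n → ZMod 2)
    (hχ : cutPartition lo hi F ≤ Setoid.ker χ) :
    ∑ e ∈ F, coboundary χ e • edgeSketch E lo hi φ e = ∑ g ∈ E \ F, coboundary χ g • φ g := by
  -- A forest edge outside `F` crosses no fundamental cut of `F`, so its ends lie in one class and
  -- `χ` cannot separate them.
  have hτ : ∀ e ∈ τ, e ∉ F → coboundary χ e = 0 := by
    intro e he heF
    have hsep : ∀ e' ∈ F, coboundary (intervalIndicator (lo e') (hi e')) e = 0 := by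
      intro e' he'
      by_cases hmem : e' ∈ τ
      · exact (h.separates e' hmem e he).2 fun heq => heF (heq ▸ he')
      · rw [h.eq_zero e' hmem, map_zero, Pi.zero_apply]
    induction e using Sym2.ind with
    | _ x y =>
      rw [coboundary_mk_eq_zero]
      exact hχ (cutPartition_rel.2 fun e' he' => coboundary_mk_eq_zero.1 (hsep e' he'))
  have hcob : ∀ g ∈ E, coboundary χ g =
      ∑ e ∈ F, coboundary χ e * coboundary (intervalIndicator (lo e) (hi e)) g := by
    intro g hg
    have hg' := (hE g).1 hg
    induction g using Sym2.ind with
    | _ x y => exact h.coboundary_eq_sum χ F hτ x y (SimpleGraph.Adj.reachable hg')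
  have hswap : ∑ e ∈ F, coboundary χ e •
      ∑ g ∈ E, coboundary (intervalIndicator (lo e) (hi e)) g • φ g =
      ∑ g ∈ E, coboundary χ g • φ g := by
    simp only [Finset.smul_sum, smul_smul]
    rw [Finset.sum_comm]
    exact Finset.sum_congr rfl fun g hg => by rw [hcob g hg, Finset.sum_smul]
  simp only [edgeSketch, smul_add, Finset.sum_add_distrib]
  rw [hswap, ← Finset.sum_sdiff hF, add_assoc, ZModModule.add_self, add_zero]

theorem sum_coboundary_smul {V : Type*} {K : Type} [AddCommGroup K] [Module (ZMod 2) K]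
    (H : Finset (Sym2 V)) (φ : Sym2 V → K) (χ : V → ZMod 2) :
    ∑ g ∈ H, coboundary χ g • φ g = ∑ g ∈ cutEdges H χ, φ g := by
  rw [cutEdges, Finset.sum_filter]
  refine Finset.sum_congr rfl fun g _ => ?_
  split_ifs with h
  · have h1 : coboundary χ g = 1 := Fin.eq_one_of_ne_zero _ h
    rw [h1, one_smul]
  · rw [not_not.1 h, zero_smul]

/-- The edges of which a fingerprint is seen in the sketches `σ`. -/
def decodedEdges {V : Type*} [Fintype (Sym2 V)] {J : ℕ} {K : Type} [Field K] (z : K)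
    (σ : (V → ZMod 2) → Fin (J + 1) → K) (χ : V → ZMod 2) (e : Sym2 V) : Prop :=
  ∃ (i : Fin (J + 1)) (X : Finset (Sym2 V)), X.card ≤ 512 ∧ fingerprint z X = σ χ i ∧ e ∈ X

/-- The partition that the decoder starts from. -/
noncomputable def decoderStart {n R J : ℕ} {K K' : Type} (Q : Finset (EdgeLabel n R J K K')) :
    Setoid (Fin n) :=
  Setoid.ker fun x (l : Q) => intervalIndicator l.1.2.1.1 l.1.2.1.2 x

/-- The partition that the decoder ends with. -/
noncomputable def decoderPartition {n R J : ℕ} {K K' : Type} [Field K] [Algebra (ZMod 2) K]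
    (z : K) (Q : Finset (EdgeLabel n R J K K')) : Setoid (Fin n) :=
  mergeRun (decoderStart Q) (fun r : Fin R => decodedEdges z fun χ (i : Fin (J + 1)) =>
    ∑ l ∈ Q, coboundary χ l.1 • l.2.2.1 (r, i)) R

/-- The answer of the decoder. -/
def DecidesConnected {n R J : ℕ} {K K' : Type} [Field K] [Algebra (ZMod 2) K]
    [Field K'] [Algebra (ZMod 2) K'] (a b : VertexLabel n K)
    (Q : Finset (EdgeLabel n R J K K')) : Prop :=
  a.1 = b.1 ∧ ∀ χ : Fin n → ZMod 2, decoderPartition a.2.2 Q ≤ Setoid.ker χ →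
    ∑ l ∈ Q, coboundary χ l.1 • l.2.2.2 = 0 → χ a.2.1 = χ b.2.1

/-- The label of a vertex. -/
noncomputable def vertexLabel {n : ℕ} {K : Type} (G : SimpleGraph (Fin n)) (z : K) (v : Fin n) :
    VertexLabel n K :=
  (Quot.out (G.connectedComponentMk v), v, z)

/-- The label of an edge. -/
noncomputable def edgeLabel {n R J : ℕ} {K K' : Type} [Field K] [Algebra (ZMod 2) K]
    [Field K'] [Algebra (ZMod 2) K'] (E : Finset (Sym2 (Fin n)))
    (lo hi : Sym2 (Fin n) → Fin (n + 1)) (w : Fin R → Sym2 (Fin n) → Fin (2 ^ J)) (z : K) (z' : K')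
    (e : Sym2 (Fin n)) : EdgeLabel n R J K K' :=
  (e, (lo e, hi e), fun p => edgeSketch E lo hi (fun g => if (w p.1 g : ℕ) < 2 ^ (p.2 : ℕ) then
      z ^ (Fintype.equivFin (Sym2 (Fin n)) g : ℕ) else 0) e,
    edgeSketch E lo hi (fun g => z' ^ (Fintype.equivFin (Sym2 (Fin n)) g : ℕ)) e)

/-- The partition that the decoder ends with if it is not misled by fingerprints. -/
noncomputable def idealPartition {n R J : ℕ} (lo hi : Sym2 (Fin n) → Fin (n + 1))
    (F H : Finset (Sym2 (Fin n))) (w : Fin R → Sym2 (Fin n) → Fin (2 ^ J)) (N : ℕ) :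
    Setoid (Fin n) :=
  mergeRun (cutPartition lo hi F) (fun r => seenEdges H (w r)) N

/-- No small set of edges has the fingerprint of a sampled cut that the decoder looks at. -/
def FingerprintsFaithful {n R J : ℕ} {K : Type} [Field K] (lo hi : Sym2 (Fin n) → Fin (n + 1))
    (F H : Finset (Sym2 (Fin n))) (w : Fin R → Sym2 (Fin n) → Fin (2 ^ J)) (z : K) : Prop :=
  ∀ (r : Fin R) (q : Quotient (idealPartition lo hi F H w r)) (i : Fin (J + 1))
    (X : Finset (Sym2 (Fin n))), X.card ≤ 512 →
    fingerprint z X =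
      fingerprint z (sampledCut H (w r) i (classIndicator (idealPartition lo hi F H w r) q)) →
    X = sampledCut H (w r) i (classIndicator (idealPartition lo hi F H w r) q)

/-- Among the cuts that respect the partition that the decoder ends with, only the empty one has
the fingerprint `0`. -/
def CutsDetected {n R J : ℕ} {K' : Type} [Field K'] (lo hi : Sym2 (Fin n) → Fin (n + 1))
    (F H : Finset (Sym2 (Fin n))) (w : Fin R → Sym2 (Fin n) → Fin (2 ^ J)) (z' : K') : Prop :=
  ∀ χ : Fin n → ZMod 2, idealPartition lo hi F H w R ≤ Setoid.ker χ →
    fingerprint z' (cutEdges H χ) = 0 → cutEdges H χ = ∅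

/-- Once the fingerprints do not mislead, the decoder reproduces the ideal partition and can test
whether the cut of an admissible `χ` in `G - F` is empty. A function with an empty cut is constant
on the components of `G - F`. Conversely, separated vertices in one component of `G` are told apart
by such an admissible function. Different components of `G` need the separate test, since sketches
carry no information across them. -/
theorem decidesConnected_iff {n R J : ℕ} {K K' : Type} [Field K] [Algebra (ZMod 2) K]
    [Field K'] [Algebra (ZMod 2) K'] {G : SimpleGraph (Fin n)}
    {lo hi : Sym2 (Fin n) → Fin (n + 1)} {τ : Set (Sym2 (Fin n))} (h : HasIntervalCuts G lo hi τ)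
    (E F : Finset (Sym2 (Fin n))) (hE : ∀ e, e ∈ E ↔ e ∈ G.edgeSet) (hF : F ⊆ E)
    (w : Fin R → Sym2 (Fin n) → Fin (2 ^ J)) (z : K) (z' : K')
    (hz : FingerprintsFaithful lo hi F (E \ F) w z) (hz' : CutsDetected lo hi F (E \ F) w z')
    (Q : Finset (EdgeLabel n R J K K'))
    (hQ : ∀ l, l ∈ Q ↔ ∃ e ∈ F, edgeLabel E lo hi w z z' e = l) (s t : Fin n) :
    DecidesConnected (vertexLabel G z s) (vertexLabel G z t) Q ↔
      (G.deleteEdges (F : Set (Sym2 (Fin n)))).Reachable s t := by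
  classical
  set H := E \ F with hH
  have hQ' : Q = F.image (edgeLabel E lo hi w z z') := by
    ext l; rw [hQ, Finset.mem_image]
  have hinj : Function.Injective (edgeLabel (R := R) (J := J) E lo hi w z z') :=
    fun e e' he => congrArg Prod.fst he
  have hstart : decoderStart Q = cutPartition lo hi F := by
    ext x y
    rw [cutPartition_rel, decoderStart, Setoid.ker_def, funext_iff, Subtype.forall]
    constructor
    · intro hall e he
      exact hall (edgeLabel E lo hi w z z' e) ((hQ _).2 ⟨e, he, rfl⟩)
    · intro hall l hl
      obtain ⟨e, he, rfl⟩ := (hQ l).1 hl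
      exact hall e he
  have hsumr : ∀ χ, cutPartition lo hi F ≤ Setoid.ker χ → ∀ (r : Fin R) (i : Fin (J + 1)),
      ∑ l ∈ Q, coboundary χ l.1 • l.2.2.1 (r, i) = fingerprint z (sampledCut H (w r) i χ) := by
    intro χ hχ r i
    rw [hQ', Finset.sum_image fun e _ e' _ he => hinj he]
    simp only [edgeLabel]
    rw [h.sum_edgeSketch E F hE hF _ χ hχ, sum_coboundary_smul, sampledCut, fingerprint,
      Finset.sum_filter]
  have hsum' : ∀ χ, cutPartition lo hi F ≤ Setoid.ker χ →
      ∑ l ∈ Q, coboundary χ l.1 • l.2.2.2 = fingerprint z' (cutEdges H χ) := by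
    intro χ hχ
    rw [hQ', Finset.sum_image fun e _ e' _ he => hinj he]
    simp only [edgeLabel]
    rw [h.sum_edgeSketch E F hE hF _ χ hχ, sum_coboundary_smul, fingerprint]
  -- The comparison follows the ideal run, the only one for which faithfulness is assumed.
  have hpart : decoderPartition z Q = idealPartition lo hi F H w R := by
    symm
    rw [decoderPartition, hstart, idealPartition]
    refine mergeRun_congr _ R fun r _ q e => ?_
    have hle : cutPartition lo hi F ≤ Setoid.ker (classIndicator _ q) :=
      (le_mergeRun _ _ _).trans (le_ker_classIndicator _ q)
    constructor
    · rintro ⟨i, hi, he⟩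
      exact ⟨i, _, hi, (hsumr _ hle r i).symm, he⟩
    · rintro ⟨i, X, hX, hfp, he⟩
      have := hz r q i X hX (hfp.trans (hsumr _ hle r i))
      subst this
      exact ⟨i, hX, he⟩
  have hHadj : ∀ x y, s(x, y) ∈ H ↔ (G.deleteEdges (F : Set (Sym2 (Fin n)))).Adj x y := by
    intro x y
    rw [hH, Finset.mem_sdiff, hE, SimpleGraph.deleteEdges_adj, Finset.mem_coe,
      SimpleGraph.mem_edgeSet]
  have hcutF : cutPartition lo hi F ≤ idealPartition lo hi F H w R := le_mergeRun _ _ _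
  have hcut0 : ∀ χ : Fin n → ZMod 2, cutEdges H χ = ∅ ↔
      ∀ x y, (G.deleteEdges (F : Set (Sym2 (Fin n)))).Adj x y → χ x = χ y := by
    intro χ
    rw [cutEdges, Finset.filter_eq_empty_iff]
    constructor
    · intro hall x y hxy
      exact coboundary_mk_eq_zero.1 (not_not.1 (hall ((hHadj x y).2 hxy)))
    · intro hall e he
      induction e using Sym2.ind with
      | _ x y => exact not_not.2 (coboundary_mk_eq_zero.2 (hall x y ((hHadj x y).1 he)))
  have hcomp : Quot.out (G.connectedComponentMk s) = Quot.out (G.connectedComponentMk t) ↔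
      G.Reachable s t := by
    rw [← SimpleGraph.ConnectedComponent.eq]
    exact (Function.LeftInverse.injective Quot.out_eq).eq_iff
  unfold DecidesConnected
  simp only [vertexLabel, hpart, hcomp]
  constructor
  · rintro ⟨hr, hall⟩
    by_contra hnot
    set χ₀ : Fin n → ZMod 2 :=
      cutIndicator {v | (G.deleteEdges (F : Set (Sym2 (Fin n)))).Reachable s v} with hχ₀
    have hχ₀adj : ∀ x y, (G.deleteEdges (F : Set (Sym2 (Fin n)))).Adj x y → χ₀ x = χ₀ y := by
      intro x y hxy
      rw [hχ₀, cutIndicator_eq_iff]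
      exact ⟨fun hx => SimpleGraph.Reachable.trans hx hxy.reachable,
        fun hy => SimpleGraph.Reachable.trans hy hxy.symm.reachable⟩
    -- The indicator `χ₀` need not respect the partition by the cuts of `F`, whose classes may meet
    -- several components of `G`. The combination `χ` of these cuts does respect it, and on each
    -- component of `G` it differs from `χ₀` by a constant.
    set χ : Fin n → ZMod 2 :=
      ∑ e ∈ F, coboundary χ₀ e • intervalIndicator (lo e) (hi e) with hχ
    have hχχ₀ : ∀ x y, G.Reachable x y → (χ x = χ y ↔ χ₀ x = χ₀ y) := by
      intro x y hxy
      have := h.coboundary_eq_sum χ₀ F (fun e he heF => by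
        have heE := (hE e).2 (h.mem_edgeSet e he)
        have heH : e ∈ H := Finset.mem_sdiff.2 ⟨heE, heF⟩
        induction e using Sym2.ind with
        | _ x y => exact coboundary_mk_eq_zero.2 (hχ₀adj x y ((hHadj x y).1 heH))) x y hxy
      rw [← coboundary_mk_eq_zero, ← coboundary_mk_eq_zero, coboundary_mk, coboundary_mk, this, hχ]
      simp only [Finset.sum_apply, Pi.smul_apply, smul_eq_mul, mul_add, Finset.sum_add_distrib]
    have hχadj : ∀ x y, (G.deleteEdges (F : Set (Sym2 (Fin n)))).Adj x y → χ x = χ y :=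
      fun x y hxy => (hχχ₀ x y ((SimpleGraph.deleteEdges_le _) hxy).reachable).2 (hχ₀adj x y hxy)
    have hχker : idealPartition lo hi F H w R ≤ Setoid.ker χ := by
      refine mergeRun_le ?_ ?_ R
      · intro x y hxy
        rw [Setoid.ker_def, hχ]
        simp only [Finset.sum_apply, Pi.smul_apply, smul_eq_mul]
        exact Finset.sum_congr rfl fun e he => by rw [cutPartition_rel.1 hxy e he]
      · intro r ψ x y hxy
        exact hχadj x y ((hHadj x y).1 (mem_of_seenEdges hxy))
    have hst := hall χ hχker (by
      rw [hsum' χ (hcutF.trans hχker), (hcut0 χ).2 hχadj, fingerprint, Finset.sum_empty])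
    rw [hχχ₀ s t hr, hχ₀, cutIndicator_eq_iff] at hst
    exact hnot (hst.1 (SimpleGraph.Reachable.refl s))
  · intro hr
    refine ⟨hr.mono (SimpleGraph.deleteEdges_le _), fun χ hχ hsum => ?_⟩
    rw [hsum' χ (hcutF.trans hχ)] at hsum
    have hadj := (hcut0 χ).1 (hz' χ hχ hsum)
    have hconst : ∀ x y, (G.deleteEdges (F : Set (Sym2 (Fin n)))).Reachable x y → χ x = χ y := by
      rintro x y ⟨p⟩
      induction p with
      | nil => rfl
      | cons hxy _ ih => exact (hadj _ _ hxy).trans ih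
    exact hconst s t hr

/-! ### The probability of being misled -/

/-- The class of `x` is determined by which of the `2|F|` interval ends are at most `x`. These sets
of ends grow with `x`, so their cardinality already identifies them. -/
theorem card_quotient_cutPartition_le {n : ℕ} (lo hi : Sym2 (Fin n) → Fin (n + 1))
    (F : Finset (Sym2 (Fin n))) :
    Nat.card (Quotient (cutPartition lo hi F)) ≤ 2 * F.card + 1 := by
  classical
  set ends : Fin n → Finset (Sym2 (Fin n) × Bool) := fun x =>
    (F ×ˢ Finset.univ).filter fun p => (if p.2 then (hi p.1 : ℕ) else lo p.1) ≤ x with hends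
  have hcard : ∀ x, (ends x).card ≤ 2 * F.card := fun x =>
    (Finset.card_filter_le _ _).trans_eq (by simp [mul_comm])
  have hmono : ∀ x y, x ≤ y → ends x ⊆ ends y := fun x y hxy =>
    Finset.monotone_filter_right _ fun p _ hp => le_trans hp hxy
  have hrel : ∀ x y, ends x = ends y → cutPartition lo hi F x y := by
    intro x y hxy
    rw [cutPartition_rel]
    intro e he
    have hmem : ∀ (b : Bool) z, (e, b) ∈ ends z ↔ (if b then (hi e : ℕ) else lo e) ≤ z := by
      intro b z
      simp [hends, he]
    have h1 := hmem false x
    have h2 := hmem false y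
    have h3 := hmem true x
    have h4 := hmem true y
    rw [hxy] at h1 h3
    simp only [Bool.false_eq_true, if_false, if_true] at h1 h2 h3 h4
    rw [intervalIndicator, cutIndicator_eq_iff]
    change (_ ∧ _) ↔ (_ ∧ _)
    rw [← h1, ← h2, ← not_le, ← not_le, ← h3, ← h4]
  have hinj : Function.Injective fun q : Quotient (cutPartition lo hi F) =>
      (⟨(ends q.out).card, Nat.lt_succ_of_le (hcard _)⟩ : Fin (2 * F.card + 1)) := by
    intro q q' hqq
    have hc : (ends q.out).card = (ends q'.out).card := congrArg Fin.val hqq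
    rw [← q.out_eq, ← q'.out_eq]
    apply Quotient.sound
    rcases le_total q.out q'.out with hle | hle
    · exact hrel _ _ (Finset.eq_of_subset_of_card_le (hmono _ _ hle) hc.ge)
    · exact hrel _ _ (Finset.eq_of_subset_of_card_le (hmono _ _ hle) hc.le).symm
  simpa using Nat.card_le_card_of_injective _ hinj

/-- Some round of merging with at least `T` active classes leaves more than three quarters
of them. -/
def SlowRound {n R J : ℕ} (lo hi : Sym2 (Fin n) → Fin (n + 1)) (F H : Finset (Sym2 (Fin n)))
    (T : ℕ) (w : Fin R → Sym2 (Fin n) → Fin (2 ^ J)) : Prop :=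
  ∃ r : Fin R, T ≤ (activeClasses (idealPartition lo hi F H w r) H).card ∧
    3 * (activeClasses (idealPartition lo hi F H w r) H).card <
      4 * (activeClasses (mergeStep (idealPartition lo hi F H w r) (seenEdges H (w r))) H).card

/-- The partition before round `r` does not depend on the samples of round `r`; with all other
samples frozen, the bound for a single round applies. -/
theorem freq_slowRound_le {n R J : ℕ} (lo hi : Sym2 (Fin n) → Fin (n + 1))
    (F H : Finset (Sym2 (Fin n))) (T : ℕ) (hJ : Fintype.card (Sym2 (Fin n)) ≤ 2 ^ J) :
    freq (SlowRound (R := R) (J := J) lo hi F H T) ≤ R * (2 / 2 ^ T) := by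
  refine (freq_exists_le _ (ε := 2 / 2 ^ T) ?_).trans (by rw [Fintype.card_fin])
  intro r
  refine freq_pi_le _ r (by positivity) fun w => ?_
  have hsame : ∀ y, idealPartition lo hi F H (Function.update w r y) r =
      idealPartition lo hi F H w r := by
    intro y
    refine mergeRun_congr _ _ fun r' hr' q e => ?_
    rw [Function.update_of_ne (Fin.ne_of_lt hr')]
  by_cases hT : T ≤ (activeClasses (idealPartition lo hi F H w r) H).card
  · refine (freq_mono fun y hy => ?_).trans ((freq_slow_mergeStep_le _ H J hJ).trans
      (div_le_div_of_nonneg_left two_pos.le (by positivity) (pow_le_pow_right₀ one_le_two hT)))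
    rw [hsame, Function.update_self] at hy
    exact hy.2
  · refine (freq_mono (Q := fun _ => False) fun y hy => ?_).trans ?_
    · rw [hsame] at hy
      exact hT hy.1
    · simp only [freq, Nat.card_of_isEmpty, Nat.cast_zero, zero_div]
      positivity

theorem card_activeClasses_idealPartition_le {n R J : ℕ} {lo hi : Sym2 (Fin n) → Fin (n + 1)}
    {F H : Finset (Sym2 (Fin n))} {T k : ℕ} {w : Fin R → Sym2 (Fin n) → Fin (2 ^ J)}
    (hw : ¬ SlowRound lo hi F H T w) (hT : T ≤ k) (hk : 3 ^ R * (2 * F.card + 1) ≤ 4 ^ R * k) :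
    (activeClasses (idealPartition lo hi F H w R) H).card ≤ k := by
  have key : ∀ r ≤ R, (activeClasses (idealPartition lo hi F H w r) H).card ≤ T ∨
      4 ^ r * (activeClasses (idealPartition lo hi F H w r) H).card ≤
        3 ^ r * (2 * F.card + 1) := by
    intro r
    induction r with
    | zero =>
      intro _
      right
      rw [pow_zero, pow_zero, one_mul, one_mul]
      refine le_trans ?_ (card_quotient_cutPartition_le lo hi F)
      have := Fintype.ofFinite (Quotient (cutPartition lo hi F))
      rw [Nat.card_eq_fintype_card]
      exact Finset.card_le_univ (α := Quotient (cutPartition lo hi F)) _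
    | succ r ih =>
      intro hr
      have hstep : idealPartition lo hi F H w (r + 1) =
          mergeStep (idealPartition lo hi F H w r) (seenEdges H (w ⟨r, hr⟩)) := by
        rw [idealPartition, mergeRun, dif_pos (show r < R from hr)]
        rfl
      have hself := card_activeClasses_mergeStep_le_self (idealPartition lo hi F H w r) H
        (seenEdges H (w ⟨r, hr⟩))
      rw [← hstep] at hself
      by_cases hTr : (activeClasses (idealPartition lo hi F H w r) H).card ≤ T
      · exact Or.inl (hself.trans hTr)
      · right
        have h1 := (ih (by omega)).resolve_left hTr
        have h2 : 4 * (activeClasses (idealPartition lo hi F H w (r + 1)) H).card ≤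
            3 * (activeClasses (idealPartition lo hi F H w r) H).card := by
          by_contra hcon
          rw [hstep] at hcon
          exact hw ⟨⟨r, hr⟩, (not_le.1 hTr).le, not_le.1 hcon⟩
        calc _ = 4 ^ r * (4 * (activeClasses (idealPartition lo hi F H w (r + 1)) H).card) := by
              ring
          _ ≤ 4 ^ r * (3 * (activeClasses (idealPartition lo hi F H w r) H).card) := by gcongr
          _ = 3 * (4 ^ r * (activeClasses (idealPartition lo hi F H w r) H).card) := by ring
          _ ≤ 3 * (3 ^ r * (2 * F.card + 1)) := by gcongr
          _ = _ := by ring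
  rcases key R le_rfl with h | h
  · exact h.trans hT
  · exact Nat.le_of_mul_le_mul_left (h.trans hk) (by positivity)

/-- The union runs over rounds, classes, levels and candidate sets, a number polynomial in the
parameters. Since `w` is fixed, the cuts in question do not depend on `z`. -/
theorem freq_not_fingerprintsFaithful_le {n R J m : ℕ} {K : Type} [Field K] [Finite K]
    (lo hi : Sym2 (Fin n) → Fin (n + 1)) (F H : Finset (Sym2 (Fin n)))
    (w : Fin R → Sym2 (Fin n) → Fin (2 ^ J))
    (hm : Nat.card {X : Finset (Sym2 (Fin n)) // X.card ≤ 512} ≤ m) :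
    freq (fun z : K => ¬ FingerprintsFaithful lo hi F H w z) ≤
      R * (n * ((J + 1 : ℕ) * (m *
        (Fintype.card (Sym2 (Fin n)) / Nat.card K)))) := by
  classical
  set N := Fintype.card (Sym2 (Fin n)) with hN
  have hpos : (0 : ℝ) ≤ N / Nat.card K := by positivity
  have hiff : ∀ z : K, ¬ FingerprintsFaithful lo hi F H w z ↔
      ∃ (r : Fin R) (q : Quotient (idealPartition lo hi F H w r)) (i : Fin (J + 1))
        (X : {X : Finset (Sym2 (Fin n)) // X.card ≤ 512}),
        fingerprint z X.1 =
          fingerprint z (sampledCut H (w r) i (classIndicator (idealPartition lo hi F H w r) q)) ∧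
        X.1 ≠ sampledCut H (w r) i (classIndicator (idealPartition lo hi F H w r) q) := by
    intro z
    unfold FingerprintsFaithful
    push Not
    simp only [Subtype.exists, exists_prop]
  simp only [hiff]
  have hbound : ∀ r : Fin R, freq (fun z : K =>
      ∃ (q : Quotient (idealPartition lo hi F H w r)) (i : Fin (J + 1))
        (X : {X : Finset (Sym2 (Fin n)) // X.card ≤ 512}),
        fingerprint z X.1 =
          fingerprint z (sampledCut H (w r) i (classIndicator (idealPartition lo hi F H w r) q)) ∧
        X.1 ≠ sampledCut H (w r) i (classIndicator (idealPartition lo hi F H w r) q)) ≤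
      n * ((J + 1 : ℕ) * (m * (N / Nat.card K))) := by
    intro r
    have := Fintype.ofFinite (Quotient (idealPartition lo hi F H w r))
    have hq : (Fintype.card (Quotient (idealPartition lo hi F H w r)) : ℝ) ≤ n := by
      have := Fintype.card_le_of_surjective _
        (Quotient.mk_surjective (s := idealPartition lo hi F H w r))
      rw [Fintype.card_fin] at this
      exact_mod_cast this
    refine (freq_exists_le _ (ε := (J + 1 : ℕ) * (m * (N / Nat.card K)))
      fun q => ?_).trans (by gcongr)
    refine (freq_exists_le _ (ε := m * (N / Nat.card K))
      fun i => ?_).trans (by rw [Fintype.card_fin])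
    refine (freq_exists_le _ (ε := (N / Nat.card K)) fun X => ?_).trans ?_
    · by_cases hX : X.1 = sampledCut H (w r) i (classIndicator (idealPartition lo hi F H w r) q)
      · simp only [hX, ne_eq, not_true, and_false]
        simpa [freq] using hpos
      · exact (freq_mono fun z hz => hz.1).trans (freq_fingerprint_eq_le hX)
    · gcongr
      rwa [← Nat.card_eq_fintype_card]
  exact (freq_exists_le _ hbound).trans (by rw [Fintype.card_fin])

/-- An edge of `H` with ends in different classes has both of them active, so the cut of `χ` depends
only on the active classes where `χ` is 1. Hence at most `2 ^ k` cuts arise from `k` active classes.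
-/
theorem exists_cutEdges_eq {V : Type*} [Finite V] (P : Setoid V) (H : Finset (Sym2 V))
    (χ : V → ZMod 2) (hχ : P ≤ Setoid.ker χ) :
    ∃ S ⊆ activeClasses P H, cutEdges H χ = cutEdges H (∑ q ∈ S, classIndicator P q) := by
  classical
  set S := (activeClasses P H).filter fun q => χ q.out = 1 with hS
  refine ⟨S, Finset.filter_subset _ _, Finset.filter_congr fun e he => not_congr ?_⟩
  induction e using Sym2.ind with
  | _ u v =>
    rw [coboundary_mk_eq_zero, coboundary_mk_eq_zero]
    have hval : ∀ x, (∑ q ∈ S, classIndicator P q) x = if Quotient.mk P x ∈ S then 1 else 0 := by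
      intro x
      rw [Finset.sum_apply, ← Finset.sum_ite_eq' S (Quotient.mk P x) fun _ => (1 : ZMod 2)]
      refine Finset.sum_congr rfl fun q _ => ?_
      simp only [classIndicator, cutIndicator, Set.indicator_apply, Set.mem_ofPred_eq,
        Pi.one_apply, eq_comm]
    by_cases huv : Quotient.mk P u = Quotient.mk P v
    · rw [hval, hval, huv]
      simpa using hχ (Quotient.exact huv)
    · have hu : Quotient.mk P u ∈ activeClasses P H :=
        mem_activeClasses.2 ⟨_, he, coboundary_classIndicator_mk_ne_zero huv⟩
      have hv : Quotient.mk P v ∈ activeClasses P H := mem_activeClasses.2 ⟨_, he, by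
        rw [Sym2.eq_swap]; exact coboundary_classIndicator_mk_ne_zero (Ne.symm huv)⟩
      have hout : ∀ x, χ (Quotient.mk P x).out = χ x := fun x =>
        hχ (Quotient.exact (Quotient.mk P x).out_eq)
      have hval' : ∀ x, Quotient.mk P x ∈ activeClasses P H →
          (∑ q ∈ S, classIndicator P q) x = χ x := by
        intro x hx
        rw [hval, hS]
        simp only [Finset.mem_filter, hx, true_and, hout]
        split_ifs with h1
        · exact h1.symm
        · by_contra h0
          exact h1 (Fin.eq_one_of_ne_zero _ (Ne.symm h0))
      rw [hval' u hu, hval' v hv]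

theorem freq_not_cutsDetected_le {n R J k : ℕ} {K' : Type} [Field K'] [Finite K']
    (lo hi : Sym2 (Fin n) → Fin (n + 1)) (F H : Finset (Sym2 (Fin n)))
    (w : Fin R → Sym2 (Fin n) → Fin (2 ^ J))
    (hk : (activeClasses (idealPartition lo hi F H w R) H).card ≤ k) :
    freq (fun z' : K' => ¬ CutsDetected lo hi F H w z') ≤
      2 ^ k * (Fintype.card (Sym2 (Fin n)) / Nat.card K') := by
  classical
  set P := idealPartition lo hi F H w R with hP
  have hpos : (0 : ℝ) ≤ Fintype.card (Sym2 (Fin n)) / Nat.card K' := by positivity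
  have h := freq_exists_mem_le (Ω := K') (activeClasses P H).powerset
    (fun S (z' : K') => cutEdges H (∑ q ∈ S, classIndicator P q) ≠ ∅ ∧
      fingerprint z' (cutEdges H (∑ q ∈ S, classIndicator P q)) = fingerprint z' (∅ : Finset (Sym2 (Fin n))))
    (ε := Fintype.card (Sym2 (Fin n)) / Nat.card K') ?_
  · refine (freq_mono fun z' hz' => ?_).trans (h.trans ?_)
    · unfold CutsDetected at hz'
      push Not at hz'
      obtain ⟨χ, hχ, hfp, hne⟩ := hz'
      obtain ⟨S, hS, heq⟩ := exists_cutEdges_eq P H χ hχ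
      refine ⟨S, Finset.mem_powerset.2 hS, ?_, ?_⟩
      · rw [← heq]; exact Finset.nonempty_iff_ne_empty.1 (by simpa using hne)
      · rw [← heq, hfp, fingerprint, Finset.sum_empty]
    · rw [Finset.card_powerset]
      push_cast
      gcongr
      norm_num
  · intro S _
    by_cases h0 : cutEdges H (∑ q ∈ S, classIndicator P q) = ∅
    · simp only [h0, ne_eq, not_true, false_and]
      simpa [freq] using hpos
    · exact (freq_mono fun z hz => hz.2).trans (freq_fingerprint_eq_le h0)

theorem freq_misled_le {n R J T k m : ℕ} {K K' : Type} [Field K] [Finite K] [Field K'] [Finite K']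
    (lo hi : Sym2 (Fin n) → Fin (n + 1)) (F H : Finset (Sym2 (Fin n)))
    (hJ : Fintype.card (Sym2 (Fin n)) ≤ 2 ^ J) (hT : T ≤ k)
    (hm : Nat.card {X : Finset (Sym2 (Fin n)) // X.card ≤ 512} ≤ m)
    (hk : 3 ^ R * (2 * F.card + 1) ≤ 4 ^ R * k) :
    freq (fun ω : (Fin R → Sym2 (Fin n) → Fin (2 ^ J)) × K × K' =>
      ¬ (FingerprintsFaithful lo hi F H ω.1 ω.2.1 ∧ CutsDetected lo hi F H ω.1 ω.2.2)) ≤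
      R * (2 / 2 ^ T) +
      (R * (n * ((J + 1 : ℕ) * (m *
        (Fintype.card (Sym2 (Fin n)) / Nat.card K)))) +
      2 ^ k * (Fintype.card (Sym2 (Fin n)) / Nat.card K')) := by
  set Ω := (Fin R → Sym2 (Fin n) → Fin (2 ^ J)) × K × K'
  have h1 : freq (fun ω : Ω => SlowRound lo hi F H T ω.1) ≤ R * (2 / 2 ^ T) :=
    (freq_fst_le _).trans (freq_slowRound_le lo hi F H T hJ)
  have h2 : freq (fun ω : Ω => ¬ FingerprintsFaithful lo hi F H ω.1 ω.2.1) ≤ _ :=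
    freq_prod_le _ (by positivity) fun w => (freq_fst_le (A := K) (B := K') fun z =>
      ¬ FingerprintsFaithful lo hi F H w z).trans 
        (freq_not_fingerprintsFaithful_le lo hi F H w hm)
  have h3 : freq (fun ω : Ω => ¬ SlowRound lo hi F H T ω.1 ∧ ¬ CutsDetected lo hi F H ω.1 ω.2.2) ≤
      2 ^ k * (Fintype.card (Sym2 (Fin n)) / Nat.card K') := by
    refine freq_prod_le _ (by positivity) fun w => freq_prod_le _ (by positivity) fun z => ?_
    by_cases hw : SlowRound lo hi F H T w
    · simp only [hw, not_true, false_and]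
      simp only [freq, Nat.card_of_isEmpty, Nat.cast_zero, zero_div]
      positivity
    · refine (freq_mono fun z' hz' => hz'.2).trans (freq_not_cutsDetected_le lo hi F H w
        (card_activeClasses_idealPartition_le hw hT hk))
  refine le_trans (freq_mono fun ω hω => ?_) ((freq_or_le _ _).trans (add_le_add h1
    ((freq_or_le _ _).trans (add_le_add h2 h3))))
  tauto

theorem ten_mul_le_pow {a : ℕ} : 10 * a ≤ 2 ^ (4 * a) := by
  induction a with
  | zero => simp
  | succ a ih =>
    have : 1 ≤ 2 ^ (4 * a) := Nat.one_le_two_pow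
    rw [mul_add, mul_add, pow_add]
    omega

theorem card_sym2_fin_le {n a : ℕ} (hn : n ≤ 2 ^ a) (h1 : 1 ≤ n) :
    Fintype.card (Sym2 (Fin n)) ≤ 2 ^ (2 * a) := by
  rw [Sym2.card, Fintype.card_fin, Nat.choose_two_right]
  have h2 : (n + 1) * (n + 1 - 1) ≤ 2 * (n * n) := by
    rw [Nat.add_sub_cancel]; nlinarith
  calc (n + 1) * (n + 1 - 1) / 2 ≤ n * n := by omega
    _ ≤ 2 ^ a * 2 ^ a := Nat.mul_le_mul hn hn
    _ = 2 ^ (2 * a) := by rw [← pow_add]; congr 1; ring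

/-- With the parameters of the labeling scheme, the decoder is misled with probability at most
`2 ^ (-c a)`. -/
theorem freq_misled_le_inv_pow {n R a c k w w' : ℕ} {K K' : Type} [Field K] [Finite K]
    [Field K'] [Finite K'] (lo hi : Sym2 (Fin n) → Fin (n + 1)) (F H : Finset (Sym2 (Fin n)))
    (hn : n ≤ 2 ^ a) (h1 : 1 ≤ n) (ha : 1 ≤ a) (hR : R ≤ 10 * a) (hT : (c + 8) * a ≤ k)
    (hw : (1549 + c) * a ≤ w) (hw' : k + (c + 4) * a ≤ w') (hK : Nat.card K = 2 ^ w)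
    (hK' : Nat.card K' = 2 ^ w') (hk : 3 ^ R * (2 * F.card + 1) ≤ 4 ^ R * k) :
    freq (fun ω : (Fin R → Sym2 (Fin n) → Fin (2 ^ (2 * a))) × K × K' =>
      ¬ (FingerprintsFaithful lo hi F H ω.1 ω.2.1 ∧ CutsDetected lo hi F H ω.1 ω.2.2)) ≤
      1 / 2 ^ (c * a) := by
  have hN := card_sym2_fin_le hn h1
  have hN3 : Fintype.card (Sym2 (Fin n)) + 1 ≤ 2 ^ (3 * a) := by
    have h2 : 1 ≤ 2 ^ (2 * a) := Nat.one_le_two_pow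
    have h3 : 2 ≤ 2 ^ a := by simpa using Nat.pow_le_pow_right two_pos ha
    calc _ ≤ 2 ^ (2 * a) * 2 := by omega
      _ ≤ 2 ^ (2 * a) * 2 ^ a := Nat.mul_le_mul_left _ h3
      _ = 2 ^ (3 * a) := by rw [← pow_add]; congr 1; ring
  have hpow : ∀ s, Nat.card {X : Finset (Sym2 (Fin n)) // X.card ≤ s} ≤ 2 ^ (3 * s * a) := by
    intro s
    refine (card_finset_card_le s).trans ((Nat.pow_le_pow_left hN3 s).trans_eq ?_)
    rw [← pow_mul]
    congr 1
    ring
  -- The exponent is `3 * 512`: each element of a set of size at most 512 costs `3a` bits.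
  have hm : Nat.card {X : Finset (Sym2 (Fin n)) // X.card ≤ 512} ≤ 2 ^ (1536 * a) := hpow 512
  refine (freq_misled_le (T := (c + 8) * a) (k := k) lo hi F H hN hT hm hk).trans ?_
  have hRr : (R : ℝ) ≤ 2 ^ (4 * a) := by exact_mod_cast hR.trans ten_mul_le_pow
  have hnr : (n : ℝ) ≤ 2 ^ a := by exact_mod_cast hn
  have hNr : (Fintype.card (Sym2 (Fin n)) : ℝ) ≤ 2 ^ (2 * a) := by exact_mod_cast hN
  have hJr : ((2 * a + 1 : ℕ) : ℝ) ≤ 2 ^ (4 * a) := by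
    exact_mod_cast (show 2 * a + 1 ≤ 10 * a by omega).trans ten_mul_le_pow
  have h2a : (2 : ℝ) ≤ 2 ^ a := by
    exact_mod_cast (show 2 ≤ 2 ^ a by simpa using Nat.pow_le_pow_right two_pos ha)
  have hKr : (2 : ℝ) ^ ((1549 + c) * a) ≤ Nat.card K := by
    rw [hK]; exact_mod_cast Nat.pow_le_pow_right two_pos hw
  have hKr' : (2 : ℝ) ^ (k + (c + 4) * a) ≤ Nat.card K' := by
    rw [hK']; exact_mod_cast Nat.pow_le_pow_right two_pos hw'
  have hmr : ((2 ^ (1536 * a) : ℕ) : ℝ) = 2 ^ (1536 * a) := by push_cast; rfl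
  have hpos : ∀ k : ℕ, (0 : ℝ) < 2 ^ k := fun k => by positivity
  have e1 : (R : ℝ) * (2 / 2 ^ ((c + 8) * a)) ≤ 1 / 2 ^ ((c + 2) * a) := by
    calc (R : ℝ) * (2 / 2 ^ ((c + 8) * a)) ≤ 2 ^ (4 * a) * (2 ^ a / 2 ^ ((c + 8) * a)) := by gcongr
      _ = 1 / 2 ^ ((c + 3) * a) := by
          rw [← mul_div_assoc, ← pow_add, div_eq_div_iff (hpos _).ne' (hpos _).ne', one_mul,
            ← pow_add]
          congr 1; ring
      _ ≤ _ := by gcongr <;> norm_num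
  -- In units of `a`, the exponents `4 + 1 + 4 + 1536 + 2` add up to 1547; the constant 1549 in the
  -- field size leaves `c + 2`.
  have e2 : (R : ℝ) * (n * ((2 * a + 1 : ℕ) * ((2 ^ (1536 * a) : ℕ) *
      (Fintype.card (Sym2 (Fin n)) / Nat.card K)))) ≤ 1 / 2 ^ ((c + 2) * a) := by
    rw [hmr]
    calc _ ≤ (2 : ℝ) ^ (4 * a) * (2 ^ a * (2 ^ (4 * a) * (2 ^ (1536 * a) *
          (2 ^ (2 * a) / 2 ^ ((1549 + c) * a))))) := by gcongr
      _ = 1 / 2 ^ ((c + 2) * a) := by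
          simp only [← mul_div_assoc, ← pow_add]
          rw [div_eq_div_iff (hpos _).ne' (hpos _).ne', one_mul, ← pow_add]
          congr 1; ring
  have e3 : (2 : ℝ) ^ k * (Fintype.card (Sym2 (Fin n)) / Nat.card K') ≤
      1 / 2 ^ ((c + 2) * a) := by
    calc _ ≤ (2 : ℝ) ^ k * (2 ^ (2 * a) / 2 ^ (k + (c + 4) * a)) := by gcongr
      _ = 1 / 2 ^ ((c + 2) * a) := by
          simp only [← mul_div_assoc, ← pow_add]
          rw [div_eq_div_iff (hpos _).ne' (hpos _).ne', one_mul, ← pow_add]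
          congr 1; ring
  -- Each of the three errors is at most a quarter of the allowance.
  have e4 : (1 : ℝ) / 2 ^ ((c + 2) * a) ≤ 1 / 2 ^ (c * a) / 4 := by
    rw [add_mul, pow_add, ← div_div]
    gcongr
    calc (4 : ℝ) = 2 ^ 2 := by norm_num
      _ ≤ 2 ^ (2 * a) := pow_le_pow_right₀ one_le_two (by omega)
  have e5 : (0 : ℝ) < 1 / 2 ^ (c * a) := by positivity
  linarith

/-! ### Labels as bit strings -/

theorem bits_injective : Function.Injective Nat.bits := by
  intro m n h
  have h2 : Nat.digits 2 m = Nat.digits 2 n := by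
    rw [Nat.digits_two_eq_bits, Nat.digits_two_eq_bits, h]
  exact Nat.digits_inj_iff.1 h2

theorem length_bits_le {m k : ℕ} (h : m < 2 ^ k) : (Nat.bits m).length ≤ k := by
  rw [Nat.size_eq_bits_len]
  exact Nat.size_le.2 h

/-- A bit string that names an element of a finite type, together with two parameters. -/
noncomputable def encodeWithParams {α : Type} [Finite α] (n f : ℕ) (x : α) : BitString :=
  Nat.bits (Nat.pair (Nat.pair n f) (Finite.equivFin α x))

/-- A bit string that names an element of a finite type. -/
noncomputable def encodeElement {α : Type} [Finite α] (x : α) : BitString :=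
  Nat.bits (Finite.equivFin α x)

theorem encodeElement_injective {α : Type} [Finite α] :
    Function.Injective (encodeElement : α → BitString) := fun _ _ h =>
  (Finite.equivFin α).injective (Fin.val_injective (bits_injective h))

theorem length_encodeElement_le {α : Type} [Finite α] {k : ℕ} (h : Nat.card α ≤ 2 ^ k) (x : α) :
    (encodeElement x).length ≤ k :=
  length_bits_le ((Fin.is_lt _).trans_le h)

theorem length_encodeWithParams_le {α : Type} [Finite α] {n f k : ℕ} (hn : n < 2 ^ k)
    (hf : f < 2 ^ k) (h : Nat.card α ≤ 2 ^ (2 * k)) (x : α) :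
    (encodeWithParams n f x).length ≤ 4 * k := by
  have hlt : ∀ {x y j : ℕ}, x < 2 ^ j → y < 2 ^ j → Nat.pair x y < 2 ^ (2 * j) := by
    intro x y j hx hy
    refine (Nat.pair_lt_max_add_one_sq x y).trans_le ?_
    rw [mul_comm, pow_mul]
    exact Nat.pow_le_pow_left (max_lt hx hy) 2
  have := hlt (hlt hn hf) ((Finite.equivFin α x).is_lt.trans_le h)
  rw [← mul_assoc] at this
  exact length_bits_le this

/-- The decoder on bit strings made of decoders on finite types of labels. -/
noncomputable def bitDecoder (A B : ℕ → ℕ → Type) [∀ n f, Finite (A n f)] [∀ n f, Finite (B n f)]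
    (decides : ∀ n f, A n f → A n f → Finset (B n f) → Prop) : LabelDecoder :=
  open Classical in fun a b Q => decide (∃ (n f : ℕ) (x y : A n f) (S : Finset (B n f)),
    encodeWithParams n f x = a ∧ encodeWithParams n f y = b ∧
    (∀ q, q ∈ Q ↔ ∃ l ∈ S, encodeElement l = q) ∧ decides n f x y S)

/-- The vertex labels reveal `n` and `f`, hence the finite types in which all labels live. The
encodings are injective, so the search has only one witness. -/
theorem bitDecoder_eq_true_iff {A B : ℕ → ℕ → Type} [∀ n f, Finite (A n f)]
    [∀ n f, Finite (B n f)] {decides : ∀ n f, A n f → A n f → Finset (B n f) → Prop} {n f : ℕ}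
    (x y : A n f) (S : Finset (B n f)) (Q : Finset BitString)
    (hQ : ∀ q, q ∈ Q ↔ ∃ l ∈ S, encodeElement l = q) :
    bitDecoder A B decides (encodeWithParams n f x) (encodeWithParams n f y) Q = true ↔
      decides n f x y S := by
  simp only [bitDecoder, decide_eq_true_eq]
  constructor
  · rintro ⟨n', f', x', y', S', hx, hy, hS, hdec⟩
    obtain ⟨h1, h2⟩ := Nat.pair_eq_pair.1 (bits_injective hx)
    obtain ⟨rfl, rfl⟩ := Nat.pair_eq_pair.1 h1
    have hx' := (Finite.equivFin _).injective (Fin.val_injective h2)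
    have hy' := (Finite.equivFin _).injective
      (Fin.val_injective (Nat.pair_eq_pair.1 (bits_injective hy)).2)
    have hSS : S' = S := by
      ext l
      have hl := (hS (encodeElement l)).symm.trans (hQ (encodeElement l))
      simpa [encodeElement_injective.eq_iff] using hl
    rwa [← hx', ← hy', ← hSS]
  · exact fun h => ⟨n, f, x, y, S, rfl, rfl, hQ, h⟩

/-! ### Parameters and label lengths -/

/-- The number of rounds of merging in the labeling scheme. -/
noncomputable def roundCount (n f : ℕ) : ℕ := ⌈3 * Real.logb 2 (f / Real.logb 2 n ^ 2)⌉₊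

/-- The field of the fingerprints that identify small cuts. -/
abbrev SmallField (c n : ℕ) : Type := GaloisField 2 ((1549 + c) * Nat.clog 2 n)

/-- The field of the fingerprints that detect cuts. -/
abbrev LargeField (c n : ℕ) : Type :=
  GaloisField 2 ((c + 8) * Nat.clog 2 n + 3 * Nat.clog 2 n ^ 2 + (c + 4) * Nat.clog 2 n)

/-- Three rounds at least halve the count, as `(3/4)^3 = 27/64 < 1/2`. -/
theorem three_quarters_pow_mul_rpow_le_one {L : ℝ} {R : ℕ} (h : 3 * L ≤ R) :
    (3 / 4 : ℝ) ^ R * 2 ^ L ≤ 1 := by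
  have h1 : (3 / 4 : ℝ) ^ R ≤ (2 : ℝ) ^ (-L) := by
    have h2 : (3 / 4 : ℝ) ^ (3 : ℕ) ≤ 1 / 2 := by norm_num
    rcases le_or_gt 0 L with hL | hL
    · calc (3 / 4 : ℝ) ^ R = (3 / 4 : ℝ) ^ (R : ℝ) := (Real.rpow_natCast _ _).symm
        _ ≤ (3 / 4 : ℝ) ^ (3 * L) :=
            Real.rpow_le_rpow_of_exponent_ge (by norm_num) (by norm_num) h
        _ = ((3 / 4 : ℝ) ^ (3 : ℕ)) ^ L := by
            rw [Real.rpow_mul (by norm_num)]; norm_num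
        _ ≤ (1 / 2 : ℝ) ^ L := Real.rpow_le_rpow (by norm_num) h2 hL
        _ = _ := by rw [one_div, Real.inv_rpow (by norm_num), Real.rpow_neg (by norm_num)]
    · exact (pow_le_one₀ (by norm_num) (by norm_num)).trans
        (Real.one_le_rpow one_le_two (by linarith))
  calc _ ≤ (2 : ℝ) ^ (-L) * 2 ^ L := by gcongr
    _ = 1 := by rw [← Real.rpow_add two_pos]; simp

/-- Numerical facts on the parameters of the labeling scheme. -/
theorem scheme_parameters {n f : ℕ} (hn : 2 ≤ n) (hf : 2 * Real.logb 2 n ^ 2 ≤ (f : ℝ))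
    (hf3 : f ≤ n ^ 3) :
    1 ≤ Real.logb 2 n ∧ 1 ≤ Real.logb 2 (f / Real.logb 2 n ^ 2) ∧ 1 ≤ Nat.clog 2 n ∧
    (Nat.clog 2 n : ℝ) ≤ 2 * Real.logb 2 n ∧
    (roundCount n f : ℝ) ≤ 4 * Real.logb 2 (f / Real.logb 2 n ^ 2) ∧
    roundCount n f ≤ 10 * Nat.clog 2 n ∧
    ∀ m ≤ f, 3 ^ roundCount n f * (2 * m + 1) ≤ 4 ^ roundCount n f * (3 * Nat.clog 2 n ^ 2) := by
  set l := Real.logb 2 n with hl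
  set L := Real.logb 2 (f / l ^ 2) with hL
  set a := Nat.clog 2 n with ha
  have hn' : (2 : ℝ) ≤ n := by exact_mod_cast hn
  have hl1 : 1 ≤ l := by
    rw [hl, Real.le_logb_iff_rpow_le one_lt_two (by linarith)]
    simpa using hn'
  have hl0 : 0 < l ^ 2 := by positivity
  have hfl : 2 ≤ f / l ^ 2 := by rwa [le_div_iff₀ hl0]
  have hL1 : 1 ≤ L := by
    rw [hL, Real.le_logb_iff_rpow_le one_lt_two (by linarith)]
    simpa using hfl
  have hla : l ≤ a := by
    rw [hl, Real.logb_le_iff_le_rpow one_lt_two (by linarith), Real.rpow_natCast]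
    exact_mod_cast Nat.le_pow_clog one_lt_two n
  have ha1 : 1 ≤ a := by
    have : (1 : ℝ) ≤ a := hl1.trans hla
    exact_mod_cast this
  have hal : (a : ℝ) ≤ l + 1 := by
    have h1 := Nat.pow_pred_clog_lt_self one_lt_two hn
    have h2 : ((a - 1 : ℕ) : ℝ) ≤ l := by
      rw [hl, Real.le_logb_iff_rpow_le one_lt_two (by linarith), Real.rpow_natCast]
      exact_mod_cast h1.le
    rw [Nat.cast_sub ha1] at h2
    push_cast at h2
    linarith
  have hLl : L ≤ 3 * l := by
    have hpow : (2 : ℝ) ^ (3 * l) = n ^ 3 := by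
      rw [mul_comm, Real.rpow_mul (by norm_num), hl, Real.rpow_logb two_pos (by norm_num)
        (by linarith)]
      exact_mod_cast Real.rpow_natCast (n : ℝ) 3
    rw [hL, Real.logb_le_iff_le_rpow one_lt_two (by linarith), hpow]
    have : (f : ℝ) ≤ n ^ 3 := by exact_mod_cast hf3
    exact (div_le_self (by positivity) (one_le_pow₀ hl1)).trans this
  have hceil : (roundCount n f : ℝ) < 3 * L + 1 := Nat.ceil_lt_add_one (by linarith)
  refine ⟨hl1, hL1, ha1, by linarith, by linarith, ?_, ?_⟩
  · have h1 : (roundCount n f : ℝ) ≤ 10 * a := by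
      have : (1 : ℝ) ≤ a := by exact_mod_cast ha1
      linarith
    exact_mod_cast h1
  · intro m hm
    have hround : 3 * L ≤ roundCount n f := Nat.le_ceil _
    have h34 := three_quarters_pow_mul_rpow_le_one hround
    have h2L : (2 : ℝ) ^ L = f / l ^ 2 :=
      Real.rpow_logb two_pos (by norm_num) (by linarith)
    rw [h2L, div_pow, div_mul_div_comm, div_le_one (by positivity)] at h34
    have hm' : (m : ℝ) ≤ f := by exact_mod_cast hm
    have hf1 : (1 : ℝ) ≤ f := by nlinarith
    -- The initial count satisfies `2m + 1 ≤ 3f`, and the rounds shrink `f` to at most `log² n ≤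
    -- a²`; this is the source of `3a²`.
    have hreal : (3 : ℝ) ^ roundCount n f * (2 * m + 1) ≤
        4 ^ roundCount n f * (3 * a ^ 2) := by
      calc (3 : ℝ) ^ roundCount n f * (2 * m + 1) ≤ 3 ^ roundCount n f * (3 * f) := by
            gcongr; linarith
        _ = 3 * (3 ^ roundCount n f * f) := by ring
        _ ≤ 3 * (4 ^ roundCount n f * l ^ 2) := by gcongr
        _ ≤ 3 * (4 ^ roundCount n f * a ^ 2) := by gcongr
        _ = _ := by ring
    exact_mod_cast hreal

theorem card_edgeLabel_le {n R J b w w' : ℕ} {K K' : Type} [Finite K] [Finite K']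
    (hN : Fintype.card (Sym2 (Fin n)) ≤ 2 ^ b) (hn : n + 1 ≤ 2 ^ b) (hK : Nat.card K = 2 ^ w)
    (hK' : Nat.card K' = 2 ^ w') :
    Nat.card (EdgeLabel n R J K K') ≤ 2 ^ (3 * b + w * (R * (J + 1)) + w') := by
  have h : Nat.card (EdgeLabel n R J K K') = Fintype.card (Sym2 (Fin n)) *
      ((n + 1) * (n + 1) * ((2 ^ w) ^ (R * (J + 1)) * 2 ^ w')) := by
    simp [EdgeLabel, Nat.card_prod, Nat.card_fun, hK, hK']
  rw [h, ← pow_mul]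
  calc _ ≤ 2 ^ b * (2 ^ b * 2 ^ b * (2 ^ (w * (R * (J + 1))) * 2 ^ w')) := by gcongr
    _ = _ := by simp only [← pow_add]; congr 1; ring

theorem card_vertexLabel_le {n b w : ℕ} {K : Type} [Finite K] (hn : n ≤ 2 ^ b)
    (hK : Nat.card K = 2 ^ w) : Nat.card (VertexLabel n K) ≤ 2 ^ (2 * b + w) := by
  have h : Nat.card (VertexLabel n K) = n * (n * 2 ^ w) := by
    simp [VertexLabel, Nat.card_prod, hK]
  rw [h]
  calc _ ≤ 2 ^ b * (2 ^ b * 2 ^ w) := by gcongr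
    _ = _ := by simp only [← pow_add]; congr 1; ring

/-- The labels of the vertices in the labeling scheme. -/
abbrev SchemeVertexLabel (c n _f : ℕ) : Type := VertexLabel n (SmallField c n)

/-- The labels of the edges in the labeling scheme. -/
abbrev SchemeEdgeLabel (c n f : ℕ) : Type :=
  EdgeLabel n (roundCount n f) (2 * Nat.clog 2 n) (SmallField c n) (LargeField c n)

/-- The decoder of the labeling scheme. -/
noncomputable def schemeDecoder (c : ℕ) : LabelDecoder :=
  bitDecoder (SchemeVertexLabel c) (SchemeEdgeLabel c) fun _ _ => DecidesConnected

/-- The random choices of the labeling scheme. -/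
abbrev SchemeRandomness (c n f : ℕ) : Type :=
  (Fin (roundCount n f) → Sym2 (Fin n) → Fin (2 ^ (2 * Nat.clog 2 n))) × SmallField c n ×
    LargeField c n

theorem card_smallField {c n : ℕ} (hn : 1 ≤ Nat.clog 2 n) :
    Nat.card (SmallField c n) = 2 ^ ((1549 + c) * Nat.clog 2 n) :=
  GaloisField.card 2 _ (by positivity)

theorem card_largeField {c n : ℕ} (hn : 1 ≤ Nat.clog 2 n) :
    Nat.card (LargeField c n) =
      2 ^ ((c + 8) * Nat.clog 2 n + 3 * Nat.clog 2 n ^ 2 + (c + 4) * Nat.clog 2 n) :=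
  GaloisField.card 2 _ (by positivity)

/-- The labels that the scheme assigns to a graph. -/
noncomputable def schemeLabels {V : Type*} (G : SimpleGraph V) {c n f : ℕ} (pos : V ≃ Fin n)
    (E : Finset (Sym2 (Fin n))) (lo hi : Sym2 (Fin n) → Fin (n + 1))
    (ω : SchemeRandomness c n f) : VertexEdgeLabels G :=
  (fun v => encodeWithParams n f
      (vertexLabel (G.comap pos.symm) ω.2.1 (pos v) : SchemeVertexLabel c n f),
    fun e => encodeElement
      (edgeLabel E lo hi ω.1 ω.2.1 ω.2.2 (e.1.map pos) : SchemeEdgeLabel c n f))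

theorem length_schemeLabels_fst_le {V : Type*} (G : SimpleGraph V) {c n f : ℕ} (pos : V ≃ Fin n)
    (E : Finset (Sym2 (Fin n))) (lo hi : Sym2 (Fin n) → Fin (n + 1))
    (ω : SchemeRandomness c n f) (hn : 2 ≤ n) (hf : 2 * Real.logb 2 n ^ 2 ≤ (f : ℝ))
    (hf3 : f ≤ n ^ 3) (v : V) :
    (((schemeLabels G pos E lo hi ω).1 v).length : ℝ) ≤ 8 * (1600 + c) * Real.logb 2 n := by
  obtain ⟨-, -, ha1, hal, -⟩ := scheme_parameters hn hf hf3
  set a := Nat.clog 2 n with ha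
  have hna : n ≤ 2 ^ a := Nat.le_pow_clog one_lt_two n
  have hlen : ((schemeLabels G pos E lo hi ω).1 v).length ≤ 4 * ((1600 + c) * a) := by
    apply length_encodeWithParams_le
    · exact hna.trans_lt (Nat.pow_lt_pow_right one_lt_two (by nlinarith))
    · calc f ≤ (2 ^ a) ^ 3 := hf3.trans (Nat.pow_le_pow_left hna 3)
        _ = 2 ^ (a * 3) := (pow_mul _ _ _).symm
        _ < _ := Nat.pow_lt_pow_right one_lt_two (by nlinarith)
    · refine (card_vertexLabel_le hna (card_smallField ha1)).trans
        (Nat.pow_le_pow_right two_pos ?_)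
      rw [← ha]
      nlinarith
  calc (((schemeLabels G pos E lo hi ω).1 v).length : ℝ) ≤ 4 * ((1600 + c) * a) := by
        exact_mod_cast hlen
    _ ≤ 4 * ((1600 + c) * (2 * Real.logb 2 n)) := by gcongr
    _ = _ := by ring

theorem length_schemeLabels_snd_le {V : Type*} (G : SimpleGraph V) {c n f : ℕ} (pos : V ≃ Fin n)
    (E : Finset (Sym2 (Fin n))) (lo hi : Sym2 (Fin n) → Fin (n + 1))
    (ω : SchemeRandomness c n f) (hn : 2 ≤ n) (hf : 2 * Real.logb 2 n ^ 2 ≤ (f : ℝ))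
    (hf3 : f ≤ n ^ 3) (e : G.edgeSet) :
    (((schemeLabels G pos E lo hi ω).2 e).length : ℝ) ≤ 100 * (1600 + c) *
      (Real.logb 2 n ^ 2 * Real.logb 2 (f / Real.logb 2 n ^ 2)) := by
  obtain ⟨hl1, hL1, ha1, hal, hR, -⟩ := scheme_parameters hn hf hf3
  set a := Nat.clog 2 n with ha
  set l := Real.logb 2 n with hl
  set L := Real.logb 2 (f / l ^ 2) with hL
  have hna : n ≤ 2 ^ a := Nat.le_pow_clog one_lt_two n
  have hn1 : n + 1 ≤ 2 ^ (2 * a) := by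
    have h3 : 2 ≤ 2 ^ a := by simpa using Nat.pow_le_pow_right two_pos ha1
    calc n + 1 ≤ 2 ^ a * 2 ^ a := by nlinarith
      _ = 2 ^ (2 * a) := by rw [← pow_add]; congr 1; ring
  have hlen : ((schemeLabels G pos E lo hi ω).2 e).length ≤ 3 * (2 * a) +
      (1549 + c) * a * (roundCount n f * (2 * a + 1)) +
      ((c + 8) * a + 3 * a ^ 2 + (c + 4) * a) :=
    length_encodeElement_le (card_edgeLabel_le (card_sym2_fin_le hna (by omega)) hn1
      (card_smallField ha1) (card_largeField ha1)) _
  have hlen' : (((schemeLabels G pos E lo hi ω).2 e).length : ℝ) ≤ 3 * (2 * a) +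
      (1549 + c) * a * (roundCount n f * (2 * a + 1)) +
      ((c + 8) * a + 3 * a ^ 2 + (c + 4) * a) := by exact_mod_cast hlen
  have ha1' : (1 : ℝ) ≤ a := by exact_mod_cast ha1
  have haa : (a : ℝ) ≤ a ^ 2 := by nlinarith
  have hc0 : (0 : ℝ) ≤ c := Nat.cast_nonneg c
  have hmid : (1549 + c) * a * (roundCount n f * (2 * a + 1)) ≤
      (1549 + c) * a * (4 * L * (3 * a)) := by gcongr; linarith
  have hsmall : 3 * (2 * (a : ℝ)) + ((c + 8) * a + 3 * a ^ 2 + (c + 4) * a) ≤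
      (21 + 2 * c) * a ^ 2 := by nlinarith
  have hA : (a : ℝ) ^ 2 ≤ 4 * l ^ 2 := by
    calc (a : ℝ) ^ 2 ≤ (2 * l) ^ 2 := by gcongr
      _ = 4 * l ^ 2 := by ring
  calc (((schemeLabels G pos E lo hi ω).2 e).length : ℝ)
      ≤ (21 + 2 * c) * a ^ 2 + (1549 + c) * a * (4 * L * (3 * a)) := by linarith
    _ ≤ (21 + 2 * c) * a ^ 2 * L + (1549 + c) * a * (4 * L * (3 * a)) := by
        gcongr ?_ + _
        exact le_mul_of_one_le_right (by positivity) hL1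
    _ = (18609 + 14 * c) * (a ^ 2 * L) := by ring
    _ ≤ (18609 + 14 * c) * (4 * l ^ 2 * L) := by gcongr
    _ ≤ (25 * (1600 + c)) * (4 * l ^ 2 * L) := by
        gcongr
        linarith
    _ = _ := by ring

/-! ### Assembling the labeling scheme -/

theorem answersCorrectly_schemeLabels {V : Type*} {G : SimpleGraph V} {c n f : ℕ} {pos : V ≃ Fin n}
    {E : Finset (Sym2 (Fin n))} {lo hi : Sym2 (Fin n) → Fin (n + 1)} {τ : Set (Sym2 (Fin n))}
    (h : HasIntervalCuts (G.comap pos.symm) lo hi τ)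
    (hE : ∀ e, e ∈ E ↔ e ∈ (G.comap pos.symm).edgeSet) (F : Finset G.edgeSet)
    {F' : Finset (Sym2 (Fin n))} (hF' : ∀ e, e ∈ F' ↔ ∃ g ∈ F, g.1.map pos = e)
    (ω : SchemeRandomness c n f)
    (hω : FingerprintsFaithful lo hi F' (E \ F') ω.1 ω.2.1 ∧
      CutsDetected lo hi F' (E \ F') ω.1 ω.2.2) (s t : V) :
    AnswersCorrectly (schemeDecoder c) (schemeLabels G pos E lo hi ω) s t F := by
  classical
  have hadj : ∀ x y, (G.comap pos.symm).Adj (pos x) (pos y) ↔ G.Adj x y := fun x y => by simp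
  have hFE : F' ⊆ E := by
    intro e he
    obtain ⟨⟨g, hg⟩, -, rfl⟩ := (hF' e).1 he
    rw [hE]
    induction g using Sym2.ind with
    | _ x y => exact (hadj x y).2 hg
  have hmemF : ∀ x y, s(pos x, pos y) ∈ F' ↔
      s(x, y) ∈ ((↑) '' (F : Set G.edgeSet) : Set (Sym2 V)) := by
    intro x y
    rw [hF', Set.mem_image]
    refine exists_congr fun g => and_congr Iff.rfl ?_
    rw [← Sym2.map_mk]
    exact (Sym2.map.injective pos.injective).eq_iff
  let iso : G.deleteEdges ((↑) '' (F : Set G.edgeSet)) ≃g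
      (G.comap pos.symm).deleteEdges (F' : Set (Sym2 (Fin n))) :=
    ⟨pos, fun {x y} => by
      rw [SimpleGraph.deleteEdges_adj, SimpleGraph.deleteEdges_adj, hadj, Finset.mem_coe, hmemF]⟩
  rw [AnswersCorrectly, ← iso.reachable_iff]
  refine (bitDecoder_eq_true_iff (A := SchemeVertexLabel c) (B := SchemeEdgeLabel c)
    (decides := fun _ _ => DecidesConnected) (n := n) (f := f) _ _
    (F'.image (edgeLabel E lo hi ω.1 ω.2.1 ω.2.2)) _ ?_).trans
    (decidesConnected_iff h E F' hE hFE ω.1 ω.2.1 ω.2.2 hω.1 hω.2 _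
      (fun l => Finset.mem_image) (pos s) (pos t))
  intro q
  simp only [Finset.mem_image, schemeLabels, hF']
  constructor
  · rintro ⟨g, hg, rfl⟩
    exact ⟨_, ⟨_, ⟨g, hg, rfl⟩, rfl⟩, rfl⟩
  · rintro ⟨_, ⟨_, ⟨g, hg, rfl⟩, rfl⟩, rfl⟩
    exact ⟨g, hg, rfl⟩

theorem one_sub_le_toOuterMeasure_map {Ω X : Type*} [Fintype Ω] [Nonempty Ω] (L : Ω → X)
    (S : Set X) (good : Ω → Prop) (hgood : ∀ ω, good ω → L ω ∈ S) {ε : ℝ}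
    (hε : freq (fun ω => ¬ good ω) ≤ ε) :
    ENNReal.ofReal (1 - ε) ≤ ((PMF.uniformOfFintype Ω).map L).toOuterMeasure S := by
  classical
  rw [PMF.toOuterMeasure_map_apply, PMF.toOuterMeasure_uniformOfFintype_apply]
  have hpos : (0 : ℝ) < Fintype.card Ω := by exact_mod_cast Fintype.card_pos
  have hsplit : Fintype.card Ω ≤ Fintype.card (L ⁻¹' S) + Nat.card {ω // ¬ good ω} := by
    rw [Nat.card_eq_fintype_card, Fintype.card_subtype fun ω => ¬ good ω,
      ← Set.toFinset_card]
    refine le_trans ?_ (Finset.card_union_le _ _)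
    refine Finset.card_le_card fun ω _ => ?_
    by_cases hω : good ω
    · exact Finset.mem_union_left _ (Set.mem_toFinset.2 (hgood ω hω))
    · exact Finset.mem_union_right _ (Finset.mem_filter.2 ⟨Finset.mem_univ _, hω⟩)
  have hreal : 1 - ε ≤ (Fintype.card (L ⁻¹' S) : ℝ) / Fintype.card Ω := by
    unfold freq at hε
    rw [Nat.card_eq_fintype_card (α := Ω)] at hε
    rw [div_le_iff₀ hpos] at hε
    rw [le_div_iff₀ hpos]
    have : (Fintype.card Ω : ℝ) ≤ Fintype.card (L ⁻¹' S) + Nat.card {ω // ¬ good ω} := by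
      exact_mod_cast hsplit
    linarith
  calc ENNReal.ofReal (1 - ε) ≤ ENNReal.ofReal
        ((Fintype.card (L ⁻¹' S) : ℝ) / Fintype.card Ω) :=
        ENNReal.ofReal_le_ofReal hreal
    _ = _ := by
        rw [ENNReal.ofReal_div_of_pos hpos, ENNReal.ofReal_natCast, ENNReal.ofReal_natCast]

/-- The labeling scheme for at most `n ^ 3` faults. -/
theorem exists_labels_of_le_cube {V : Type*} [Fintype V] (G : SimpleGraph V) (c n f : ℕ)
    (hV : Fintype.card V = n) (hn : 2 ≤ n) (hf : 2 * Real.logb 2 n ^ 2 ≤ (f : ℝ))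
    (hf3 : f ≤ n ^ 3) :
    ∃ μ : PMF (VertexEdgeLabels G),
      (∀ L ∈ μ.support,
        (∀ v : V, ((L.1 v).length : ℝ) ≤ 100 * (1600 + c) * Real.logb 2 n) ∧
        (∀ e : G.edgeSet, ((L.2 e).length : ℝ) ≤ 100 * (1600 + c) *
          (Real.logb 2 n ^ 2 * Real.logb 2 (f / Real.logb 2 n ^ 2)))) ∧
      ∀ (s t : V) (F : Finset G.edgeSet), F.card ≤ f →
        ENNReal.ofReal (1 - (n : ℝ) ^ (-(c : ℝ))) ≤
          μ.toOuterMeasure {L | AnswersCorrectly (schemeDecoder c) L s t F} := by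
  classical
  obtain ⟨pos, lo, hi, τ, h⟩ := exists_hasIntervalCuts G hV
  obtain ⟨hl1, -, ha1, -, -, hR, hk⟩ := scheme_parameters hn hf hf3
  have hna : n ≤ 2 ^ Nat.clog 2 n := Nat.le_pow_clog one_lt_two n
  set E : Finset (Sym2 (Fin n)) := (Set.toFinite (G.comap pos.symm).edgeSet).toFinset with hEdef
  have hE : ∀ e, e ∈ E ↔ e ∈ (G.comap pos.symm).edgeSet := fun e => Set.Finite.mem_toFinset _
  let _ : Fintype (SchemeRandomness c n f) := Fintype.ofFinite _
  refine ⟨(PMF.uniformOfFintype (SchemeRandomness c n f)).map (schemeLabels G pos E lo hi),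
    ?_, ?_⟩
  · intro L hL
    obtain ⟨ω, -, rfl⟩ := (PMF.mem_support_map_iff _ _ _).1 hL
    refine ⟨fun v => (length_schemeLabels_fst_le G pos E lo hi ω hn hf hf3 v).trans ?_,
      length_schemeLabels_snd_le G pos E lo hi ω hn hf hf3⟩
    gcongr
    norm_num
  · intro s t F hF
    set F' := F.image fun g => g.1.map pos with hF'
    have hF'card : F'.card ≤ f := Finset.card_image_le.trans hF
    -- Here `k = (c + 8) a + 3 a²` with `a = Nat.clog 2 n`: the first term is the threshold `T`
    -- below which rounds may be slow, the second bounds the classes left after all rounds.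
    refine one_sub_le_toOuterMeasure_map _ _ _ (fun ω hω =>
      answersCorrectly_schemeLabels h hE F (fun e => Finset.mem_image) ω hω s t)
      ((freq_misled_le_inv_pow (c := c) lo hi F' (E \ F') hna (by omega) ha1 hR
        (Nat.le_add_right _ (3 * Nat.clog 2 n ^ 2)) le_rfl le_rfl (card_smallField ha1)
        (card_largeField ha1) ?_).trans ?_)
    · exact (hk _ hF'card).trans (Nat.mul_le_mul_left _ (Nat.le_add_left _ _))
    · have hn0 : (0 : ℝ) < n := by exact_mod_cast (show 0 < n by omega)
      rw [Real.rpow_neg hn0.le, Real.rpow_natCast, one_div]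
      gcongr
      rw [mul_comm, pow_mul]
      gcongr
      exact_mod_cast hna

theorem mainTheorem8 (c : ℝ) (hc : 0 < c) :
    ∃ (C : ℝ) (D : LabelDecoder), 0 < C ∧
      ∀ (V : Type*) [Fintype V] (G : SimpleGraph V) (n f : ℕ),
        Fintype.card V = n → 2 ≤ n → 2 * Real.logb 2 n ^ 2 ≤ (f : ℝ) →
        ∃ μ : PMF (VertexEdgeLabels G),
          (∀ L ∈ μ.support,
            (∀ v : V, ((L.1 v).length : ℝ) ≤ C * Real.logb 2 n) ∧
            (∀ e : G.edgeSet, ((L.2 e).length : ℝ) ≤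
              C * (Real.logb 2 n ^ 2 * Real.logb 2 (f / Real.logb 2 n ^ 2)))) ∧
          ∀ (s t : V) (F : Finset G.edgeSet), F.card ≤ f →
            ENNReal.ofReal (1 - (n : ℝ) ^ (-c)) ≤
              μ.toOuterMeasure {L | AnswersCorrectly D L s t F} := by
  classical
  refine ⟨100 * (1600 + ⌈c⌉₊), schemeDecoder ⌈c⌉₊, by positivity, ?_⟩
  intro V _ G n f hV hn hf
  have hn' : (2 : ℝ) ≤ n := by exact_mod_cast hn
  have hl0 : 0 < Real.logb 2 n := Real.logb_pos one_lt_two (by linarith)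
  have hln : Real.logb 2 n ≤ n := by
    rw [Real.logb_le_iff_le_rpow one_lt_two (by linarith), Real.rpow_natCast]
    exact_mod_cast Nat.lt_two_pow_self.le
  have hmin : 2 * Real.logb 2 n ^ 2 ≤ ((min f (n ^ 3) : ℕ) : ℝ) := by
    rw [Nat.cast_min, le_min_iff]
    refine ⟨hf, ?_⟩
    push_cast
    calc 2 * Real.logb 2 n ^ 2 ≤ n * (n : ℝ) ^ 2 := by gcongr
      _ = (n : ℝ) ^ 3 := by ring
  -- Capping `f` at `n ^ 3` loses no queries, since `G` has at most `n ^ 2` edges, and lets vertex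
  -- labels store the bound in `O(log n)` bits. For the cube, the lower bound on `f` follows from `2
  -- ≤ n` and `log n ≤ n`.
  obtain ⟨μ, hμ, hcorrect⟩ := exists_labels_of_le_cube G ⌈c⌉₊ n (min f (n ^ 3)) hV hn hmin
    (min_le_right _ _)
  refine ⟨μ, fun L hL => ⟨(hμ L hL).1, fun e => ((hμ L hL).2 e).trans ?_⟩, ?_⟩
  · have hpos : 0 < ((min f (n ^ 3) : ℕ) : ℝ) / Real.logb 2 n ^ 2 :=
      div_pos (lt_of_lt_of_le (by positivity) hmin) (by positivity)
    have hle : ((min f (n ^ 3) : ℕ) : ℝ) ≤ f := by exact_mod_cast min_le_left _ _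
    gcongr
    norm_num
  · intro s t F hF
    have hcard : F.card ≤ n ^ 3 := by
      have h1 : F.card ≤ Nat.card (Sym2 V) := by
        have := Finset.card_le_card_of_injOn (s := F) (t := (Finset.univ : Finset (Sym2 V)))
          Subtype.val (fun _ _ => Finset.mem_univ _) Subtype.val_injective.injOn
        rwa [Finset.card_univ, ← Nat.card_eq_fintype_card] at this
      have h2 : Nat.card (Sym2 V) ≤ n * n := by
        have := Nat.card_le_card_of_surjective (fun p : V × V => s(p.1, p.2))
          (fun e => by induction e using Sym2.ind with | _ x y => exact ⟨(x, y), rfl⟩)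
        rwa [Nat.card_prod, Nat.card_eq_fintype_card (α := V), hV] at this
      calc F.card ≤ n * n := h1.trans h2
        _ ≤ n * n * n := Nat.le_mul_of_pos_right _ (by omega)
        _ = n ^ 3 := by ring
    refine le_trans (ENNReal.ofReal_le_ofReal ?_) (hcorrect s t F (le_min hF hcard))
    have : (n : ℝ) ^ (-(⌈c⌉₊ : ℝ)) ≤ (n : ℝ) ^ (-c) :=
      Real.rpow_le_rpow_of_exponent_le (by linarith) (neg_le_neg (Nat.le_ceil c))
    linarith
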